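/- **Model.** Time is divided into slots. Packets $u$ carry window sizes $w_u\ge w_{\min}$. In each slot an adaptive adversary, knowing the whole past (all states, decisions and random choices of earlier slots) but not the random choices of the current slot, first decides how many new packets to inject (each with window size $w_{\min}$) and whether to jam the slot. Then each packet in the system, independently of the others, listens with probability $c\ln^3(w_u)/w_u$ and, if it listens, also sends with probability $1/(c\ln^3 w_u)$. The slot is noisy if it is jammed or at least two packets send; if it is not jammed, it is silent if no packet sends, and successful if exactly one packet sends. A packet that sends in a successful slot leaves the system. A packet that listens replaces $w_u$ by $\max\{w_u/(1+1/(c\ln w_u)),\,w_{\min}\}$ if the slot is silent and by $w_u\,(1+1/(c\ln w_u))$ if it is noisy, and keeps $w_u$ if it is successful; all other windows are unchanged. For the state of the system at the beginning of slot $t$, let $N(t)$ be the number of packets, $H(t)=\sum_u 1/\ln w_u(t)$, let $w_{\max}$ be the largest window size, $L(t)=w_{\max}/\ln^2 w_{\max}$ (which is $0$ if there are no packets), and let $\Phi(t)=\alpha_1N(t)+\alpha_2H(t)+\alpha_3L(t)$. **Theorem (decrease in $\Phi$ over an interval $\mathcal I$, w.h.p. in $|\mathcal I|$).** Let $\gamma\ge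 1$. For every sufficiently large constant $c_\tau$ (in terms of $\gamma$), every sufficiently large $c$ (in terms of $\gamma,c_\tau$) and every sufficiently large $w_{\min}\ge 2$ (in terms of $\gamma,c_\tau,c$) there are constants $\alpha_1>\alpha_2>\alpha_3>0$ and constants $\delta,K,C>0$ such that the following holds for every adaptive adversary and every state of the system at the beginning of slot $t$ that has at least one packet and all window sizes at least $w_{\min}$. Put $$\tau=\frac1{c_\tau}\max\Big\{\frac{w_{\max}}{\ln^2 w_{\max}},\,N(t)^{1/2}\Big\},$$ let $\mathcal I$ consist of the slots $t,\dots,t'-1$ with $t'=t+\lceil\tau\rceil$, and let $\mathcal A$ and $\mathcal J$ be the numbers of packet arrivals and of jammed slots in $\mathcal I$. Then, conditionally on the state at the beginning of slot $t$, $$\Pr\big[\Phi(t')-\Phi(t)\ \ge\ K(\mathcal A+\mathcal J)-\delta\tau\big]\ \le\ C\,(1/\tau)^{\gamma}.$$ -/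

import Mathlib

open scoped ENNReal NNReal

noncomputable section

namespace Backoff

/-- What a packet does in a slot. As in the algorithm, a packet that sends also listens;
`listen` means that the packet listens without sending. -/
inductive Action where
  | sleep
  | listen
  | send
  deriving DecidableEq

instance : Fintype Action where
  elems := {.sleep, .listen, .send}
  complete := by intro a; cases a <;> decide

/-- What the channel delivers to the packets that listen. -/
inductive Feedback where
  | silent
  | success
  | noisy
  deriving DecidableEq

/-- The state of the system between two slots: the packets in the system (named by natural
numbers), their window sizes, and a bound on the names used so far, from which newly injected
packets take their names. The value of `window` matters only at packets in the system. -/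
structure Config where
  packets : Finset ℕ
  window : ℕ → ℝ
  fresh : ℕ

/-- States in which every packet has a used name and a window of size at least `wmin`. -/
def Config.Valid (wmin : ℝ) (σ : Config) : Prop :=
  ∀ u ∈ σ.packets, u < σ.fresh ∧ wmin ≤ σ.window u

/-- The injection of `a` new packets, all with window size `wmin`. -/
def Config.inject (wmin : ℝ) (σ : Config) (a : ℕ) : Config where
  packets := σ.packets ∪ Finset.Ico σ.fresh (σ.fresh + a)
  window := fun u => if u < σ.fresh then σ.window u else wmin
  fresh := σ.fresh + a

/-- The number of packets in the system. -/
def Config.N (σ : Config) : ℝ := σ.packets.card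

/-- `∑ 1 / ln w_u` over the packets in the system. -/
def Config.H (σ : Config) : ℝ := ∑ u ∈ σ.packets, 1 / Real.log (σ.window u)

/-- The largest window size in the system, `0` if there are no packets. -/
def Config.wmax (σ : Config) : ℝ :=
  if h : σ.packets.Nonempty then σ.packets.sup' h σ.window else 0

/-- `w_max / ln² w_max`, which is `0` if there are no packets. -/
def Config.L (σ : Config) : ℝ := σ.wmax / Real.log σ.wmax ^ 2

/-- The potential `α₁ N + α₂ H + α₃ L`. -/
def Config.potential (α₁ α₂ α₃ : ℝ) (σ : Config) : ℝ := α₁ * σ.N + α₂ * σ.H + α₃ * σ.L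

/-- `τ = (1 / cτ) max {w_max / ln² w_max, N ^ (1/2)}`. -/
def Config.tau (cτ : ℝ) (σ : Config) : ℝ := 1 / cτ * max σ.L (Real.sqrt σ.N)

/-- The probability `c ln³ w / w` of listening (cut off at `1`, which has no effect once `w` is
large in terms of `c`). -/
def listenProb (c w : ℝ) : ℝ≥0 := min 1 (c * Real.log w ^ 3 / w).toNNReal

/-- The probability `1 / (c ln³ w)` of sending, given that the packet listens (cut off at `1`). -/
def sendProb (c w : ℝ) : ℝ≥0 := min 1 (1 / (c * Real.log w ^ 3)).toNNReal

/-- The probability of each action for a packet with window size `w`. -/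
def actionProb (c w : ℝ) : Action → ℝ≥0
  | .sleep => 1 - listenProb c w
  | .listen => listenProb c w * (1 - sendProb c w)
  | .send => listenProb c w * sendProb c w

theorem sum_actionProb (c w : ℝ) : ∑ a, actionProb c w a = 1 := by
  have h1 : listenProb c w ≤ 1 := min_le_left _ _
  have h2 : sendProb c w ≤ 1 := min_le_left _ _
  have h : ∑ a, actionProb c w a =
      (1 - listenProb c w) + (listenProb c w * (1 - sendProb c w) +
        listenProb c w * sendProb c w) := by
    have hu : (Finset.univ : Finset Action) = {.sleep, .listen, .send} := rfl
    rw [hu, Finset.sum_insert (by decide), Finset.sum_insert (by decide), Finset.sum_singleton]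
    rfl
  rw [h, ← mul_add, tsub_add_cancel_of_le h2, mul_one, tsub_add_cancel_of_le h1]

theorem sum_prod_actionProb (c : ℝ) (σ : Config) :
    ∑ a : σ.packets → Action, ((∏ u : σ.packets, actionProb c (σ.window u) (a u) : ℝ≥0) : ℝ≥0∞) = 1 := by
  have h : ∑ a : σ.packets → Action, ∏ u : σ.packets, actionProb c (σ.window u) (a u) = 1 := by
    have := Finset.prod_univ_sum (fun _ : σ.packets => (Finset.univ : Finset Action))
      (fun u a => actionProb c (σ.window u) a)
    rw [Fintype.piFinset_univ] at this
    rw [← this]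
    simp [sum_actionProb]
  exact_mod_cast h

/-- The joint law of the actions in a slot: the packets in the system act independently of each
other, each according to its own window size. Names of packets that are not in the system are
given the action `sleep`. -/
def actionLaw (c : ℝ) (σ : Config) : PMF (ℕ → Action) :=
  (PMF.ofFintype (fun a : σ.packets → Action =>
      ((∏ u : σ.packets, actionProb c (σ.window u) (a u) : ℝ≥0) : ℝ≥0∞)) (sum_prod_actionProb c σ)).map
    (fun a u => if h : u ∈ σ.packets then a ⟨u, h⟩ else .sleep)

/-- The packets that send in a slot. -/
def Config.senders (σ : Config) (act : ℕ → Action) : Finset ℕ :=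
  σ.packets.filter (fun u => act u = .send)

/-- The ternary feedback. Jammed slots are noisy. -/
def Config.feedback (σ : Config) (jam : Bool) (act : ℕ → Action) : Feedback :=
  if jam then .noisy
  else if (σ.senders act).card = 0 then .silent
  else if (σ.senders act).card = 1 then .success
  else .noisy

/-- The new window size of a packet that accesses the channel. -/
def newWindow (c wmin w : ℝ) : Feedback → ℝ
  | .silent => max (w / (1 + 1 / (c * Real.log w))) wmin
  | .success => w
  | .noisy => w * (1 + 1 / (c * Real.log w))

/-- The effect of a slot on the packets in the system: a packet that sends successfully leaves,
and the packets that access the channel update their windows according to the feedback. -/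
def Config.resolve (c wmin : ℝ) (σ : Config) (jam : Bool) (act : ℕ → Action) : Config where
  packets := if σ.feedback jam act = .success then σ.packets \ σ.senders act else σ.packets
  window := fun u =>
    if act u = .sleep then σ.window u else newWindow c wmin (σ.window u) (σ.feedback jam act)
  fresh := σ.fresh

/-- All that happens in a slot: the state before the slot, the adversary's decisions on arrivals
and jamming, and the actions of all packets. -/
structure SlotRecord where
  before : Config
  arrivals : ℕ
  jammed : Bool
  act : ℕ → Action

/-- An adaptive adversary. For each slot it decides how many packets to inject and whether to jam,
knowing everything that happened in the earlier slots (in chronological order) and the present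
state, but not the random choices of the slot itself. -/
abbrev Adversary := List SlotRecord → Config → ℕ × Bool

/-- The law of the next `n` slots (their records are appended to the given list, and the final
state is returned as well). In each slot the adversary injects packets and fixes whether the slot is
jammed, then the packets in the system, new ones included, choose their actions at random, and then
the slot is resolved. -/
def run (c wmin : ℝ) (adv : Adversary) :
    ℕ → List SlotRecord → Config → PMF (List SlotRecord × Config)
  | 0, past, σ => PMF.pure (past, σ)
  | n + 1, past, σ =>
    (actionLaw c (σ.inject wmin (adv past σ).1)).bind fun act =>
      run c wmin adv n (past ++ [⟨σ, (adv past σ).1, (adv past σ).2, act⟩])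
        ((σ.inject wmin (adv past σ).1).resolve c wmin (adv past σ).2 act)

/-- The number of packet arrivals in a list of slots. -/
def totalArrivals (slots : List SlotRecord) : ℝ := ((slots.map SlotRecord.arrivals).sum : ℕ)

/-- The number of jammed slots in a list of slots. -/
def totalJammed (slots : List SlotRecord) : ℝ := (slots.countP SlotRecord.jammed : ℕ)

end Backoff

end

/-!
The interval is analysed through two supermartingales, and no concentration inequality other than
Markov's is needed. Let `C` be the contention `∑ 1 / w_u` of a slot, the expected number of senders.

*The energy `200 N + H`.* A listening packet changes `1 / ln w` by about `1 / (c ln³ w)`, which is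
`1 / w` divided by its listening probability. So, in a silent or noisy slot, `H` changes by about
`± C` in the mean, and, the packets being independent, exponential moments of the change factor
over the packets. At high contention nearly all slots are noisy, so that
`exp ((200 N + H) / 32)` decreases in the mean; at low contention a success, which
removes a packet, has probability at least `C` times that of silence and outweighs the increase of
`H`. In all cases the mean of the exponential changes by a factor of at most
`exp (-κ min {C, 1})` in a slot that is not jammed (`slotMean_exp_energy_le`), while arrivals and
jammed slots cost a constant each. Up to a small fraction of `τ`, the energy therefore decreases by
a multiple of `∑ min {C, 1}` with high probability (`measure_energy_le`).

*The windows.* Let `W = e ^ x` be the scale with `W / ln² W = cτ τ`. The sum over the packets of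
`(max {w, W / e} / W) ^ (c ln W)`, divided by the number of packets that have ever been in the
system and compensated for its drift, is a supermartingale up to negligible errors
(`slotMean_windowProcess_le`). The drift is downward in slots with low contention and at most a
constant multiple of the listening rate at `W` in all slots. A packet with window `W` listens about
`c ln W / cτ` times, and the exponent `c ln W` turns the polynomial factors of Markov's inequality
into the small factor `e ^ (O(1 / c))` for the windows. A maximal inequality (`run_maximal`) gives
this bound at all times.

*Conclusion* (`potential_sub_lt`). If there are many arrivals or jammed slots, their price covers
the potential increase of `O(τ)`. Otherwise, if `∑ min {C, 1}` is a constant fraction of `τ`, the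
decrease of the energy outweighs the possible increase of `L`, as `α₃` is small. Otherwise most
slots have low contention. Then `τ` cannot stem from the number of packets, because
`(W / ln² W) ^ 2` packets with windows of order at most `W` have contention above `1`; so `cτ τ = L`, and
all windows end below `W` by a factor `1 - Ω(1 / cτ)`, which decreases `L` by `Ω(τ)`.
-/

noncomputable section

namespace Backoff

/-! ### The mean over the random choices of one slot -/

/-- The assignment of actions to all names that is given by actions of the packets in the system;
all other names sleep. -/
def Config.extendAction (σ : Config) (a : σ.packets → Action) : ℕ → Action :=
  fun u => if h : u ∈ σ.packets then a ⟨u, h⟩ else .sleep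

/-- The mean of a real function of the actions under `actionLaw c σ`, as a finite sum. -/
def slotMean (c : ℝ) (σ : Config) (F : (ℕ → Action) → ℝ) : ℝ :=
  ∑ a : σ.packets → Action,
    (∏ u : σ.packets, (actionProb c (σ.window u) (a u) : ℝ)) * F (σ.extendAction a)

theorem slotMean_mono {c : ℝ} {σ : Config} {F G : (ℕ → Action) → ℝ} (h : ∀ act, F act ≤ G act) :
    slotMean c σ F ≤ slotMean c σ G :=
  Finset.sum_le_sum fun a _ => mul_le_mul_of_nonneg_left (h _)
    (Finset.prod_nonneg fun u _ => (actionProb c (σ.window u) (a u)).coe_nonneg)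

theorem slotMean_add (c : ℝ) (σ : Config) (F G : (ℕ → Action) → ℝ) :
    slotMean c σ (fun act => F act + G act) = slotMean c σ F + slotMean c σ G := by
  simp only [slotMean, mul_add, Finset.sum_add_distrib]

theorem slotMean_const_mul (c : ℝ) (σ : Config) (k : ℝ) (F : (ℕ → Action) → ℝ) :
    slotMean c σ (fun act => k * F act) = k * slotMean c σ F := by
  simp only [slotMean, Finset.mul_sum]
  exact Finset.sum_congr rfl fun a _ => by ring

theorem slotMean_sum (c : ℝ) (σ : Config) {ι : Type*} (s : Finset ι)
    (F : ι → (ℕ → Action) → ℝ) :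
    slotMean c σ (fun act => ∑ i ∈ s, F i act) = ∑ i ∈ s, slotMean c σ (F i) := by
  simp only [slotMean, Finset.mul_sum]
  exact Finset.sum_comm

theorem sum_action (f : Action → ℝ) : ∑ x, f x = f .sleep + f .listen + f .send := by
  have hu : (Finset.univ : Finset Action) = {.sleep, .listen, .send} := rfl
  rw [hu, Finset.sum_insert (by decide), Finset.sum_insert (by decide), Finset.sum_singleton]
  ring

/-- Independence of the packets: the mean of a product over the packets is the product of the
means. -/
theorem slotMean_prod (c : ℝ) (σ : Config) (g : ℕ → Action → ℝ) :
    slotMean c σ (fun act => ∏ u ∈ σ.packets, g u (act u)) =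
      ∏ u ∈ σ.packets, ∑ x, (actionProb c (σ.window u) x : ℝ) * g u x := by
  have h : ∀ a : σ.packets → Action, ∏ u ∈ σ.packets, g u (σ.extendAction a u) =
      ∏ u : σ.packets, g u (a u) := by
    intro a
    rw [← Finset.prod_coe_sort]
    refine Finset.prod_congr rfl fun u _ => ?_
    simp [Config.extendAction]
  simp only [slotMean, h, ← Finset.prod_mul_distrib]
  have := Finset.prod_univ_sum (fun _ : σ.packets => (Finset.univ : Finset Action))
    (fun u x => (actionProb c (σ.window u) x : ℝ) * g u x)
  rw [Fintype.piFinset_univ] at this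
  rw [← this, Finset.prod_coe_sort σ.packets
    (fun u => ∑ x, (actionProb c (σ.window u) x : ℝ) * g u x)]

theorem sum_coe_actionProb (c w : ℝ) : ∑ x, (actionProb c w x : ℝ) = 1 := by
  exact_mod_cast sum_actionProb c w

theorem slotMean_const (c : ℝ) (σ : Config) (k : ℝ) : slotMean c σ (fun _ => k) = k := by
  have h := slotMean_prod c σ (fun _ _ => 1)
  simp only [Finset.prod_const_one, mul_one, sum_coe_actionProb] at h
  have := slotMean_const_mul c σ k (fun _ => 1)
  simpa [h] using this

/-- The mean of a function of the action of a single packet. -/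
theorem slotMean_single {c : ℝ} {σ : Config} {u : ℕ} (hu : u ∈ σ.packets) (g : Action → ℝ) :
    slotMean c σ (fun act => g (act u)) = ∑ x, (actionProb c (σ.window u) x : ℝ) * g x := by
  classical
  have h := slotMean_prod c σ (fun v x => if v = u then g x else 1)
  have h1 : ∀ act : ℕ → Action,
      ∏ v ∈ σ.packets, (if v = u then g (act v) else 1) = g (act u) := by
    intro act
    rw [Finset.prod_ite_eq' σ.packets u (fun v => g (act v)), if_pos hu]
  simp only [h1] at h
  rw [h, ← Finset.mul_prod_erase _ _ hu, Finset.prod_eq_one, mul_one]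
  · simp
  · intro v hv
    simp [Finset.ne_of_mem_erase hv, sum_coe_actionProb]

theorem tsum_actionLaw {c : ℝ} {σ : Config} {F : (ℕ → Action) → ℝ} (hF : ∀ act, 0 ≤ F act) :
    ∑' act, actionLaw c σ act * ENNReal.ofReal (F act) = ENNReal.ofReal (slotMean c σ F) := by
  classical
  have h1 : ∀ act, actionLaw c σ act * ENNReal.ofReal (F act) =
      ∑ a : σ.packets → Action, if act = σ.extendAction a then
        ((∏ u : σ.packets, actionProb c (σ.window u) (a u) : ℝ≥0) : ℝ≥0∞) *
          ENNReal.ofReal (F act) else 0 := by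
    intro act
    rw [actionLaw, PMF.map_apply, tsum_fintype, Finset.sum_mul]
    refine Finset.sum_congr rfl fun a _ => ?_
    rw [ite_mul, zero_mul]
    rfl
  simp only [h1]
  rw [Summable.tsum_finsetSum (fun _ _ => ENNReal.summable)]
  rw [slotMean, ENNReal.ofReal_sum_of_nonneg
    (fun a _ => mul_nonneg (Finset.prod_nonneg fun u _ => NNReal.coe_nonneg _) (hF _))]
  refine Finset.sum_congr rfl fun a _ => ?_
  rw [tsum_eq_single (σ.extendAction a) (fun b hb => if_neg hb), if_pos rfl,
    ENNReal.ofReal_mul (Finset.prod_nonneg fun u _ => NNReal.coe_nonneg _)]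
  congr 1
  rw [← NNReal.coe_prod, ENNReal.ofReal_coe_nnreal]

/-! ### A maximal inequality for functions of the history -/

/-- The state at the end of a slot with `a` arrivals. -/
abbrev Config.slotEnd (c wmin : ℝ) (σ : Config) (a : ℕ) (jam : Bool) (act : ℕ → Action) : Config :=
  (σ.inject wmin a).resolve c wmin jam act

/-- The property `P` of the past and the present state holds at every time of the run that
produced the records `e.1` and the final state `e.2`. -/
def AlongRun (P : List SlotRecord → Config → Prop) (e : List SlotRecord × Config) : Prop :=
  P e.1 e.2 ∧ ∀ l r rest, e.1 = l ++ r :: rest → P l r.before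

theorem toOuterMeasure_le_one {α : Type*} (p : PMF α) (s : Set α) : p.toOuterMeasure s ≤ 1 :=
  ((PMF.toOuterMeasure p).mono (Set.subset_univ s)).trans
    ((PMF.toOuterMeasure_apply_eq_one_iff p Set.univ).2 (Set.subset_univ _)).le

/-- A maximal inequality for supermartingales up to drift `ε`: if the mean of `V` grows by at most
`ε` per slot, as long as the invariant `Inv` holds, then the probability that `V` ever reaches `r`
is at most `(V + n ε) / r`. -/
theorem run_maximal {c wmin : ℝ} {adv : Adversary} {T : ℕ} {ε r : ℝ} (hε : 0 ≤ ε) (hr : 0 < r)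
    {Inv : List SlotRecord → Config → Prop} {V : List SlotRecord → Config → ℝ}
    (hV : ∀ past σ, 0 ≤ V past σ)
    (hInv : ∀ past σ act, Inv past σ →
      Inv (past ++ [⟨σ, (adv past σ).1, (adv past σ).2, act⟩])
        (σ.slotEnd c wmin (adv past σ).1 (adv past σ).2 act))
    (hstep : ∀ past σ, Inv past σ → past.length < T →
      slotMean c (σ.inject wmin (adv past σ).1) (fun act =>
        V (past ++ [⟨σ, (adv past σ).1, (adv past σ).2, act⟩])
          (σ.slotEnd c wmin (adv past σ).1 (adv past σ).2 act)) ≤ V past σ + ε)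
    (n : ℕ) (past : List SlotRecord) (σ : Config) (hn : past.length + n ≤ T) (h0 : Inv past σ)
    (hpast : ∀ l s rest, past = l ++ s :: rest → Inv l s.before ∧ V l s.before < r) :
    (run c wmin adv n past σ).toOuterMeasure
      {e | ¬ (e.1.length = past.length + n ∧ AlongRun (fun l ρ => Inv l ρ ∧ V l ρ < r) e)} ≤
      ENNReal.ofReal ((V past σ + n * ε) / r) := by
  classical
  induction n generalizing past σ with
  | zero =>
    rw [run, PMF.toOuterMeasure_pure_apply]
    split_ifs with hmem
    · rw [← ENNReal.ofReal_one]
      refine ENNReal.ofReal_le_ofReal ?_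
      have h : r ≤ V past σ := by
        by_contra! h
        exact hmem ⟨rfl, ⟨h0, h⟩, hpast⟩
      rw [le_div_iff₀ hr]
      push_cast
      linarith
    · exact zero_le
  | succ n ih =>
    by_cases h : V past σ < r
    · rw [run, PMF.toOuterMeasure_bind_apply]
      have hnext : ∀ act, (run c wmin adv n
          (past ++ [⟨σ, (adv past σ).1, (adv past σ).2, act⟩])
          (σ.slotEnd c wmin (adv past σ).1 (adv past σ).2 act)).toOuterMeasure
          {e | ¬ (e.1.length = past.length + (n + 1) ∧
            AlongRun (fun l ρ => Inv l ρ ∧ V l ρ < r) e)} ≤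
          ENNReal.ofReal ((V (past ++ [⟨σ, (adv past σ).1, (adv past σ).2, act⟩])
            (σ.slotEnd c wmin (adv past σ).1 (adv past σ).2 act) + n * ε) / r) := by
        intro act
        have hlen : (past ++ [(⟨σ, (adv past σ).1, (adv past σ).2, act⟩ : SlotRecord)]).length + n =
            past.length + (n + 1) := by
          simp only [List.length_append, List.length_singleton]
          omega
        have := ih (past ++ [⟨σ, (adv past σ).1, (adv past σ).2, act⟩])
          (σ.slotEnd c wmin (adv past σ).1 (adv past σ).2 act) (by omega) (hInv _ _ _ h0) ?_
        · rwa [hlen] at this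
        · intro l s rest hl
          rcases List.eq_nil_or_concat rest with rfl | ⟨rest', s', rfl⟩
          · obtain ⟨rfl, h2⟩ := List.append_inj' hl rfl
            simp only [List.cons.injEq, and_true] at h2
            subst h2
            exact ⟨h0, h⟩
          · have h3 : past ++ [(⟨σ, (adv past σ).1, (adv past σ).2, act⟩ : SlotRecord)] =
                (l ++ s :: rest') ++ [s'] := by
              rw [hl]
              simp
            obtain ⟨h4, _⟩ := List.append_inj' h3 rfl
            exact hpast l s rest' h4
      calc _ ≤ ∑' act, actionLaw c (σ.inject wmin (adv past σ).1) act *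
            ENNReal.ofReal ((V (past ++ [⟨σ, (adv past σ).1, (adv past σ).2, act⟩])
              (σ.slotEnd c wmin (adv past σ).1 (adv past σ).2 act) + n * ε) / r) :=
            ENNReal.tsum_le_tsum fun act => mul_le_mul_right (hnext act) _
        _ = _ := tsum_actionLaw fun act => by
            have := hV (past ++ [⟨σ, (adv past σ).1, (adv past σ).2, act⟩])
              (σ.slotEnd c wmin (adv past σ).1 (adv past σ).2 act)
            positivity
        _ ≤ _ := by
            refine ENNReal.ofReal_le_ofReal ?_
            have h1 := hstep past σ h0 (by omega)
            simp only [div_eq_inv_mul]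
            rw [slotMean_const_mul, slotMean_add, slotMean_const]
            refine mul_le_mul_of_nonneg_left ?_ (inv_nonneg.2 hr.le)
            push_cast
            linarith
    · refine (toOuterMeasure_le_one _ _).trans ?_
      rw [← ENNReal.ofReal_one]
      refine ENNReal.ofReal_le_ofReal ?_
      rw [le_div_iff₀ hr]
      have : 0 ≤ ((n + 1 : ℕ) : ℝ) * ε := by positivity
      linarith

/-! ### Contention and the dynamics of a slot -/

/-- The contention: the expected number of packets that send in a slot. -/
def Config.contention (σ : Config) : ℝ := ∑ u ∈ σ.packets, 1 / σ.window u

/-- The listening probability `c ln³ w / w` without the cut-off at `1`. -/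
def listenRate (c w : ℝ) : ℝ := c * Real.log w ^ 3 / w

/-- The parameters `c` and `wmin` are so large that the cut-offs in the access probabilities are
void and that one update changes `ln w` by a small amount only. -/
structure LargeParams (c wmin : ℝ) : Prop where
  hundred_le : 100 ≤ c
  exp_two_le : Real.exp 2 ≤ wmin
  rate_le : ∀ w, wmin ≤ w → c * Real.log w ^ 3 ≤ w

theorem exists_largeParams {c : ℝ} (hc : 100 ≤ c) :
    ∃ w₀, 2 ≤ w₀ ∧ ∀ wmin, w₀ ≤ wmin → LargeParams c wmin := by
  have h := (Real.isLittleO_pow_log_id_atTop (n := 3)).bound (show (0 : ℝ) < 1 / c by positivity)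
  obtain ⟨w₁, hw₁⟩ := Filter.eventually_atTop.1 h
  refine ⟨max (max w₁ 2) (Real.exp 2), le_max_of_le_left (le_max_right _ _), fun wmin hw => ?_⟩
  refine ⟨hc, (le_max_right _ _).trans hw, fun w hw' => ?_⟩
  have h1 := hw₁ w (((le_max_left _ _).trans (le_max_left _ _)).trans (hw.trans hw'))
  have h2 : (2 : ℝ) ≤ w := ((le_max_right _ _).trans (le_max_left _ _)).trans (hw.trans hw')
  have h3 : 0 ≤ Real.log w := Real.log_nonneg (by linarith)
  simp only [id, Real.norm_eq_abs, abs_of_nonneg (pow_nonneg h3 3),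
    abs_of_nonneg (show (0 : ℝ) ≤ w by linarith)] at h1
  rw [one_div, ← div_eq_inv_mul, le_div_iff₀ (by linarith)] at h1
  linarith

section Rates

variable {c wmin w : ℝ}

theorem LargeParams.two_le_log (h : LargeParams c wmin) (hw : wmin ≤ w) : 2 ≤ Real.log w := by
  rw [Real.le_log_iff_exp_le ((Real.exp_pos 2).trans_le (h.exp_two_le.trans hw))]
  exact h.exp_two_le.trans hw

theorem LargeParams.one_le_log (h : LargeParams c wmin) (hw : wmin ≤ w) : 1 ≤ Real.log w :=
  one_le_two.trans (h.two_le_log hw)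

theorem LargeParams.two_le (h : LargeParams c wmin) (hw : wmin ≤ w) : 2 ≤ w := by
  linarith [h.exp_two_le, Real.add_one_le_exp 2]

theorem LargeParams.one_div_le_listenRate (h : LargeParams c wmin) (hw : wmin ≤ w) :
    1 / w ≤ listenRate c w := by
  have h1 := h.one_le_log hw
  have h2 := h.two_le hw
  have h3 : 1 ≤ Real.log w ^ 3 := one_le_pow₀ h1
  refine div_le_div_of_nonneg_right ?_ (by linarith)
  nlinarith [h.hundred_le]

theorem LargeParams.listenRate_le_one (h : LargeParams c wmin) (hw : wmin ≤ w) :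
    listenRate c w ≤ 1 := by
  have h2 := h.two_le hw
  exact (div_le_one (by linarith)).2 (h.rate_le w hw)

theorem LargeParams.listenRate_pos (h : LargeParams c wmin) (hw : wmin ≤ w) :
    0 < listenRate c w := by
  have h2 := h.two_le hw
  exact (by positivity : (0 : ℝ) < 1 / w).trans_le (h.one_div_le_listenRate hw)

theorem LargeParams.coe_listenProb (h : LargeParams c wmin) (hw : wmin ≤ w) :
    (listenProb c w : ℝ) = listenRate c w := by
  have h1 : (listenRate c w).toNNReal ≤ 1 := Real.toNNReal_le_one.2 (h.listenRate_le_one hw)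
  change ((min 1 (listenRate c w).toNNReal : ℝ≥0) : ℝ) = _
  rw [min_eq_right h1, Real.coe_toNNReal _ (h.listenRate_pos hw).le]

theorem LargeParams.coe_sendProb (h : LargeParams c wmin) (hw : wmin ≤ w) :
    (sendProb c w : ℝ) = 1 / (c * Real.log w ^ 3) := by
  have h3 : 1 ≤ Real.log w ^ 3 := one_le_pow₀ (h.one_le_log hw)
  have h4 : 1 ≤ c * Real.log w ^ 3 := by nlinarith [h.hundred_le]
  have h1 : (1 / (c * Real.log w ^ 3)).toNNReal ≤ 1 :=
    Real.toNNReal_le_one.2 ((div_le_one (by linarith)).2 h4)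
  rw [sendProb, min_eq_right h1, Real.coe_toNNReal _ (by positivity)]

theorem LargeParams.coe_actionProb_send (h : LargeParams c wmin) (hw : wmin ≤ w) :
    (actionProb c w .send : ℝ) = 1 / w := by
  have h1 := h.one_le_log hw
  have h2 := h.two_le hw
  have h3 := h.hundred_le
  rw [actionProb, NNReal.coe_mul, h.coe_listenProb hw, h.coe_sendProb hw, listenRate]
  field_simp

theorem LargeParams.coe_actionProb_sleep (h : LargeParams c wmin) (hw : wmin ≤ w) :
    (actionProb c w .sleep : ℝ) = 1 - listenRate c w := by
  have h1 : listenProb c w ≤ 1 := min_le_left _ _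
  rw [actionProb, NNReal.coe_sub h1, h.coe_listenProb hw, NNReal.coe_one]

theorem LargeParams.coe_actionProb_listen (h : LargeParams c wmin) (hw : wmin ≤ w) :
    (actionProb c w .listen : ℝ) = listenRate c w - 1 / w := by
  have h1 := sum_coe_actionProb c w
  rw [sum_action, h.coe_actionProb_send hw, h.coe_actionProb_sleep hw] at h1
  linarith

theorem LargeParams.sum_actionProb_mul (h : LargeParams c wmin) (hw : wmin ≤ w)
    (g : Action → ℝ) :
    ∑ x, (actionProb c w x : ℝ) * g x = (1 - listenRate c w) * g .sleep +
      (listenRate c w - 1 / w) * g .listen + 1 / w * g .send := by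
  rw [sum_action, h.coe_actionProb_send hw, h.coe_actionProb_sleep hw,
    h.coe_actionProb_listen hw]

/-! ### Window updates, in terms of `ln w` -/

theorem LargeParams.mul_log_ge (h : LargeParams c wmin) (hw : wmin ≤ w) :
    100 ≤ c * Real.log w := by
  nlinarith [h.one_le_log hw, h.hundred_le]

theorem LargeParams.log_newWindow_noisy (h : LargeParams c wmin) (hw : wmin ≤ w) :
    Real.log (newWindow c wmin w .noisy) =
      Real.log w + Real.log (1 + 1 / (c * Real.log w)) := by
  have h1 := h.mul_log_ge hw
  have h2 := h.two_le hw
  have : (0 : ℝ) < 1 / (c * Real.log w) := by positivity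
  rw [newWindow, Real.log_mul (by linarith) (by linarith)]

theorem LargeParams.log_newWindow_silent (h : LargeParams c wmin) (hw : wmin ≤ w) :
    Real.log (newWindow c wmin w .silent) =
      max (Real.log w - Real.log (1 + 1 / (c * Real.log w))) (Real.log wmin) := by
  have h1 := h.mul_log_ge hw
  have h2 := h.two_le hw
  have h3 := h.two_le le_rfl
  have h4 : (0 : ℝ) < 1 / (c * Real.log w) := by positivity
  have h5 : (0 : ℝ) < w / (1 + 1 / (c * Real.log w)) := by
    apply div_pos <;> linarith
  rw [newWindow, ← Real.log_div (by linarith) (by linarith)]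
  rcases le_total (w / (1 + 1 / (c * Real.log w))) wmin with h6 | h6
  · rw [max_eq_right h6, max_eq_right (Real.log_le_log h5 h6)]
  · rw [max_eq_left h6, max_eq_left (Real.log_le_log (by linarith) h6)]

theorem log_one_add_le_self {x : ℝ} (hx : 0 ≤ x) : Real.log (1 + x) ≤ x := by
  have := Real.log_le_sub_one_of_pos (show 0 < 1 + x by linarith)
  linarith

theorem half_le_log_one_add {x : ℝ} (hx : 0 ≤ x) (hx1 : x ≤ 1) : x / 2 ≤ Real.log (1 + x) := by
  refine le_trans ?_ (Real.le_log_one_add_of_nonneg hx)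
  rw [div_le_div_iff₀ (by norm_num) (by linarith)]
  nlinarith

theorem LargeParams.le_newWindow (h : LargeParams c wmin) (hw : wmin ≤ w) (f : Feedback) :
    wmin ≤ newWindow c wmin w f := by
  cases f with
  | silent => exact le_max_right _ _
  | success => exact hw
  | noisy =>
    have h1 := h.mul_log_ge hw
    have h2 := h.two_le hw
    have h4 : (0 : ℝ) < 1 / (c * Real.log w) := by positivity
    have : w * 1 ≤ w * (1 + 1 / (c * Real.log w)) :=
      mul_le_mul_of_nonneg_left (by linarith) (by linarith)
    change wmin ≤ w * (1 + 1 / (c * Real.log w))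
    linarith

end Rates

section Configurations

variable {c wmin : ℝ} {σ : Config}

theorem Config.inject_window_of_mem (hσ : σ.Valid wmin) (a : ℕ) {u : ℕ} (hu : u ∈ σ.packets) :
    (σ.inject wmin a).window u = σ.window u := by
  simp [Config.inject, (hσ u hu).1]

theorem Config.inject_window_of_new (a : ℕ) {u : ℕ} (hu : u ∈ Finset.Ico σ.fresh (σ.fresh + a)) :
    (σ.inject wmin a).window u = wmin := by
  simp [Config.inject, (Finset.mem_Ico.1 hu).1]

theorem Config.disjoint_new (hσ : σ.Valid wmin) (a : ℕ) :
    Disjoint σ.packets (Finset.Ico σ.fresh (σ.fresh + a)) :=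
  Finset.disjoint_left.2 fun _ hu hu' =>
    (Finset.mem_Ico.1 hu').1.not_gt (hσ _ hu).1

/-- Sums over the packets after an injection. -/
theorem Config.sum_inject (hσ : σ.Valid wmin) (a : ℕ) (g : ℝ → ℝ) :
    ∑ u ∈ (σ.inject wmin a).packets, g ((σ.inject wmin a).window u) =
      ∑ u ∈ σ.packets, g (σ.window u) + a * g wmin := by
  have h1 : (σ.inject wmin a).packets = σ.packets ∪ Finset.Ico σ.fresh (σ.fresh + a) := rfl
  rw [h1, Finset.sum_union (Config.disjoint_new hσ a)]
  congr 1
  · exact Finset.sum_congr rfl fun u hu => by rw [Config.inject_window_of_mem hσ a hu]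
  · rw [Finset.sum_congr rfl (g := fun _ => g wmin)
      (fun u hu => by rw [Config.inject_window_of_new a hu])]
    simp

theorem Config.inject_valid (hσ : σ.Valid wmin) (a : ℕ) : (σ.inject wmin a).Valid wmin := by
  intro u hu
  have hu' : u ∈ σ.packets ∪ Finset.Ico σ.fresh (σ.fresh + a) := hu
  rcases Finset.mem_union.1 hu' with h | h
  · rw [Config.inject_window_of_mem hσ a h]
    exact ⟨(hσ u h).1.trans_le (Nat.le_add_right _ _), (hσ u h).2⟩
  · rw [Config.inject_window_of_new a h]
    exact ⟨(Finset.mem_Ico.1 h).2, le_rfl⟩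

theorem Config.inject_N (hσ : σ.Valid wmin) (a : ℕ) : (σ.inject wmin a).N = σ.N + a := by
  have := Config.sum_inject hσ a (fun _ => 1)
  simpa [Config.N] using this

theorem Config.inject_H (hσ : σ.Valid wmin) (a : ℕ) :
    (σ.inject wmin a).H = σ.H + a * (1 / Real.log wmin) :=
  Config.sum_inject hσ a (fun w => 1 / Real.log w)

theorem Config.resolve_packets_subset (jam : Bool) (act : ℕ → Action) :
    (σ.resolve c wmin jam act).packets ⊆ σ.packets := by
  unfold Config.resolve
  dsimp only
  split_ifs
  · exact Finset.sdiff_subset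
  · exact subset_rfl

theorem Config.resolve_valid (h : LargeParams c wmin) (hσ : σ.Valid wmin) (jam : Bool)
    (act : ℕ → Action) : (σ.resolve c wmin jam act).Valid wmin := by
  intro u hu
  have hu' := hσ u (Config.resolve_packets_subset jam act hu)
  refine ⟨hu'.1, ?_⟩
  simp only [Config.resolve]
  split_ifs
  · exact hu'.2
  · exact h.le_newWindow hu'.2 _

theorem Config.resolve_N_le (jam : Bool) (act : ℕ → Action) :
    (σ.resolve c wmin jam act).N ≤ σ.N := by
  exact Nat.cast_le.2 (Finset.card_le_card (Config.resolve_packets_subset jam act))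

theorem Config.card_senders_of_success {jam : Bool} {act : ℕ → Action}
    (h : σ.feedback jam act = .success) : (σ.senders act).card = 1 := by
  unfold Config.feedback at h
  split_ifs at h
  assumption

theorem Config.resolve_N_of_success {jam : Bool} {act : ℕ → Action}
    (h : σ.feedback jam act = .success) : (σ.resolve c wmin jam act).N = σ.N - 1 := by
  have h1 := Config.card_senders_of_success h
  have h2 : (σ.resolve c wmin jam act).packets = σ.packets \ σ.senders act := by
    simp [Config.resolve, h]
  have h3 := Finset.card_sdiff_add_card_eq_card
    (show σ.senders act ⊆ σ.packets from Finset.filter_subset _ _)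
  rw [Config.N, Config.N, h2, ← h3, h1]
  push_cast
  ring

theorem Config.resolve_packets_of_ne {jam : Bool} {act : ℕ → Action}
    (h : σ.feedback jam act ≠ .success) : (σ.resolve c wmin jam act).packets = σ.packets := by
  simp [Config.resolve, h]

/-- At most one packet leaves in a slot. -/
theorem Config.le_resolve_N (jam : Bool) (act : ℕ → Action) :
    σ.N - 1 ≤ (σ.resolve c wmin jam act).N := by
  by_cases h : σ.feedback jam act = .success
  · rw [Config.resolve_N_of_success h]
  · rw [Config.N, Config.N, Config.resolve_packets_of_ne h]
    linarith

end Configurations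

/-! ### Quantities that are read off the history -/

theorem totalArrivals_append (l : List SlotRecord) (r : SlotRecord) :
    totalArrivals (l ++ [r]) = totalArrivals l + r.arrivals := by
  simp [totalArrivals]

theorem totalJammed_append (l : List SlotRecord) (r : SlotRecord) :
    totalJammed (l ++ [r]) = totalJammed l + if r.jammed then 1 else 0 := by
  cases h : r.jammed <;> simp [totalJammed, h]

theorem totalArrivals_nonneg (l : List SlotRecord) : 0 ≤ totalArrivals l := Nat.cast_nonneg _

theorem totalJammed_nonneg (l : List SlotRecord) : 0 ≤ totalJammed l := Nat.cast_nonneg _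

/-- What holds at every time of every run that starts with `n₀` packets. -/
structure RunInv (wmin n₀ : ℝ) (past : List SlotRecord) (σ : Config) : Prop where
  valid : σ.Valid wmin
  N_le : σ.N ≤ n₀ + totalArrivals past
  le_N : n₀ - past.length ≤ σ.N
  past_valid : ∀ r ∈ past, r.before.Valid wmin

theorem RunInv.next {c wmin n₀ : ℝ} (h : LargeParams c wmin) {past : List SlotRecord} {σ : Config}
    (hI : RunInv wmin n₀ past σ) (a : ℕ) (jam : Bool) (act : ℕ → Action) :
    RunInv wmin n₀ (past ++ [⟨σ, a, jam, act⟩]) (σ.slotEnd c wmin a jam act) := by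
  have h1 := Config.inject_N hI.valid a
  have h2 := Config.resolve_N_le (c := c) (wmin := wmin) (σ := σ.inject wmin a) jam act
  have h3 := Config.le_resolve_N (c := c) (wmin := wmin) (σ := σ.inject wmin a) jam act
  have h4 : (0 : ℝ) ≤ a := Nat.cast_nonneg a
  refine ⟨Config.resolve_valid h (Config.inject_valid hI.valid a) jam act, ?_, ?_, ?_⟩
  · rw [totalArrivals_append]
    linarith [hI.N_le]
  · rw [List.length_append, List.length_singleton]
    push_cast
    linarith [hI.le_N]
  · intro r hr
    rcases List.mem_append.1 hr with hr | hr
    · exact hI.past_valid r hr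
    · rw [List.mem_singleton.1 hr]
      exact hI.valid

/-! ### Exponential drift of `200 N + H` -/

section Increments

variable {c wmin w : ℝ}

/-- A silent slot increases `1 / ln w` by about `1 / (c ln³ w)`, which is `1 / w` divided by the
listening rate. -/
theorem LargeParams.inv_log_silent_le (h : LargeParams c wmin) (hw : wmin ≤ w) :
    1 / Real.log (newWindow c wmin w .silent) - 1 / Real.log w ≤
      11 / 10 / (c * Real.log w ^ 3) := by
  have hy := h.one_le_log hw
  have hc := h.hundred_le
  have hcy := h.mul_log_ge hw
  have h1 : Real.log w - 1 / (c * Real.log w) ≤ Real.log (newWindow c wmin w .silent) := by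
    rw [h.log_newWindow_silent hw]
    refine le_max_of_le_left ?_
    have := log_one_add_le_self (show 0 ≤ 1 / (c * Real.log w) by positivity)
    linarith
  set y := Real.log w
  have hd : 1 / (c * y) ≤ 1 / 100 := one_div_le_one_div_of_le (by norm_num) hcy
  have h2 : 0 < y - 1 / (c * y) := by linarith
  have h3 := one_div_le_one_div_of_le h2 h1
  have h4 : 1 / (y - 1 / (c * y)) - 1 / y ≤ 11 / 10 / (c * y ^ 3) := by
    have h5 : y - 1 / (c * y) = (c * y ^ 2 - 1) / (c * y) := by field_simp
    have h6 : 100 ≤ c * y ^ 2 := by nlinarith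
    have h7 : 0 < c * y ^ 2 - 1 := by linarith
    have h8 : 1 / (y - 1 / (c * y)) - 1 / y = 1 / (y * (c * y ^ 2 - 1)) := by
      rw [h5]
      have := h7.ne'
      field_simp
      ring
    rw [h8, div_le_div_iff₀ (by positivity) (by positivity)]
    have : 0 < y := by linarith
    nlinarith
  linarith

/-- A noisy slot decreases `1 / ln w` by about `1 / (c ln³ w)`, up to a constant factor. -/
theorem LargeParams.inv_log_noisy_le (h : LargeParams c wmin) (hw : wmin ≤ w) :
    1 / Real.log (newWindow c wmin w .noisy) - 1 / Real.log w ≤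
      -(1 / 3 / (c * Real.log w ^ 3)) := by
  have hy := h.one_le_log hw
  have hc := h.hundred_le
  have hcy := h.mul_log_ge hw
  have h1 : Real.log w + 1 / (c * Real.log w) / 2 ≤ Real.log (newWindow c wmin w .noisy) := by
    rw [h.log_newWindow_noisy hw]
    have := half_le_log_one_add (show 0 ≤ 1 / (c * Real.log w) by positivity)
      ((div_le_one (by linarith)).2 (by linarith))
    linarith
  set y := Real.log w
  have h3 := one_div_le_one_div_of_le (by positivity) h1
  have h4 : 1 / (y + 1 / (c * y) / 2) - 1 / y ≤ -(1 / 3 / (c * y ^ 3)) := by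
    have h5 : y + 1 / (c * y) / 2 = (2 * c * y ^ 2 + 1) / (2 * c * y) := by field_simp
    have h8 : 1 / (y + 1 / (c * y) / 2) - 1 / y = -(1 / (y * (2 * c * y ^ 2 + 1))) := by
      rw [h5]
      field_simp
      ring
    rw [h8, neg_le_neg_iff, div_le_div_iff₀ (by positivity) (by positivity)]
    have h6 : 100 ≤ c * y ^ 2 := by nlinarith
    nlinarith
  linarith

theorem LargeParams.listenRate_mul (h : LargeParams c wmin) (hw : wmin ≤ w) (k : ℝ) :
    listenRate c w * (k / (c * Real.log w ^ 3)) = k * (1 / w) := by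
  have h1 := h.one_le_log hw
  have h2 := h.two_le hw
  have h3 := h.hundred_le
  rw [listenRate]
  field_simp

theorem LargeParams.silent_factor_le (h : LargeParams c wmin) (hw : wmin ≤ w) :
    (1 - listenRate c w) +
      (listenRate c w - 1 / w) * Real.exp (1 / 32 * (11 / 10 / (c * Real.log w ^ 3))) ≤
      1 - 15 / 16 * (1 / w) := by
  have h1 := h.one_le_log hw
  have h2 := h.two_le hw
  have h3 := h.hundred_le
  have h4 := h.one_div_le_listenRate hw
  have h5 := h.listenRate_mul hw 1
  set q := 1 / (c * Real.log w ^ 3) with hq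
  have hq1 : q ≤ 1 / 100 := by
    refine one_div_le_one_div_of_le (by norm_num) ?_
    have : 1 ≤ Real.log w ^ 3 := one_le_pow₀ h1
    nlinarith
  have hq0 : 0 < q := by positivity
  have h6 : 11 / 10 / (c * Real.log w ^ 3) = 11 / 10 * q := by rw [hq]; ring
  rw [h6]
  have h7 : Real.exp (1 / 32 * (11 / 10 * q)) ≤ 1 + 1 / 16 * q := by
    have := Real.abs_exp_sub_one_sub_id_le (x := 1 / 32 * (11 / 10 * q))
      (by rw [abs_of_nonneg (by positivity)]; linarith)
    have := (abs_le.1 this).2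
    nlinarith
  have h8 : 0 < 1 / w := by positivity
  nlinarith [mul_le_mul_of_nonneg_left h7 (sub_nonneg.2 h4)]

theorem LargeParams.noisy_factor_le (h : LargeParams c wmin) (hw : wmin ≤ w) :
    (1 - listenRate c w) +
      listenRate c w * Real.exp (1 / 32 * -(1 / 3 / (c * Real.log w ^ 3))) ≤
      1 - 1 / 256 * (1 / w) := by
  have h1 := h.one_le_log hw
  have h2 := h.two_le hw
  have h3 := h.hundred_le
  have h4 := h.listenRate_pos hw
  have h5 := h.listenRate_mul hw 1
  set q := 1 / (c * Real.log w ^ 3) with hq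
  have hq1 : q ≤ 1 / 100 := by
    refine one_div_le_one_div_of_le (by norm_num) ?_
    have : 1 ≤ Real.log w ^ 3 := one_le_pow₀ h1
    nlinarith
  have hq0 : 0 < q := by positivity
  have h6 : 1 / 3 / (c * Real.log w ^ 3) = 1 / 3 * q := by rw [hq]; ring
  rw [h6]
  have h7 : Real.exp (1 / 32 * -(1 / 3 * q)) ≤ 1 - 1 / 256 * q := by
    have := Real.abs_exp_sub_one_sub_id_le (x := 1 / 32 * -(1 / 3 * q))
      (by rw [abs_of_nonpos (by linarith)]; linarith)
    have := (abs_le.1 this).2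
    nlinarith
  nlinarith [mul_le_mul_of_nonneg_left h7 h4.le]

end Increments

/-! ### Products over the packets, with `s i` as the probabilities of sending -/

section Products

variable {ι : Type*} {t : Finset ι} {s : ι → ℝ}

theorem prod_one_sub_mul_le_exp (hs : ∀ i ∈ t, 0 ≤ s i ∧ s i ≤ 1 / 2) {k : ℝ}
    (hk1 : k ≤ 1) : ∏ i ∈ t, (1 - k * s i) ≤ Real.exp (-(k * ∑ i ∈ t, s i)) := by
  rw [Finset.mul_sum, ← Finset.sum_neg_distrib, Real.exp_sum]
  refine Finset.prod_le_prod (fun i hi => ?_) fun i _ => Real.one_sub_le_exp_neg _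
  nlinarith [hs i hi]

theorem exp_le_prod_one_sub (hs : ∀ i ∈ t, 0 ≤ s i ∧ s i ≤ 1 / 2) :
    Real.exp (-(2 * ∑ i ∈ t, s i)) ≤ ∏ i ∈ t, (1 - s i) := by
  rw [Finset.mul_sum, ← Finset.sum_neg_distrib, Real.exp_sum]
  refine Finset.prod_le_prod (fun i _ => (Real.exp_pos _).le) fun i hi => ?_
  have h1 := hs i hi
  rw [Real.exp_neg]
  refine inv_le_of_inv_le₀ (by linarith) ?_
  rw [inv_le_iff_one_le_mul₀ (by linarith)]
  have h2 := Real.add_one_le_exp (2 * s i)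
  nlinarith [mul_le_mul_of_nonneg_right h2 (show 0 ≤ 1 - s i by linarith)]

theorem prod_le_prod_one_sub_mul_exp (hs : ∀ i ∈ t, 0 ≤ s i ∧ s i ≤ 1 / 2) :
    ∏ i ∈ t, (1 - 15 / 16 * s i) ≤ (∏ i ∈ t, (1 - s i)) * Real.exp (1 / 8 * ∑ i ∈ t, s i) := by
  rw [Finset.mul_sum, Real.exp_sum, ← Finset.prod_mul_distrib]
  refine Finset.prod_le_prod (fun i hi => by nlinarith [hs i hi]) fun i hi => ?_
  have h1 := hs i hi
  have h2 := Real.add_one_le_exp (1 / 8 * s i)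
  nlinarith [mul_le_mul_of_nonneg_left h2 (show 0 ≤ 1 - s i by linarith)]

theorem prod_mul_sum_le [DecidableEq ι] (hs : ∀ i ∈ t, 0 ≤ s i ∧ s i ≤ 1 / 2) :
    (∏ i ∈ t, (1 - s i)) * ∑ i ∈ t, s i ≤ ∑ i ∈ t, s i * ∏ j ∈ t.erase i, (1 - s j) := by
  rw [Finset.mul_sum]
  refine Finset.sum_le_sum fun i hi => ?_
  rw [← Finset.mul_prod_erase _ _ hi]
  have h1 := hs i hi
  have h2 : 0 ≤ ∏ j ∈ t.erase i, (1 - s j) :=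
    Finset.prod_nonneg fun j hj => by linarith [hs j (Finset.mem_of_mem_erase hj)]
  nlinarith [mul_nonneg h1.1 h2]

end Products

/-- The rate, in the exponent, at which `200 N + H` drifts down. -/
def driftRate : ℝ := Real.exp (-16) / 2

theorem driftRate_pos : 0 < driftRate := by unfold driftRate; positivity

theorem exp_neg_natCast_le (n : ℕ) : Real.exp (-n) ≤ (1 / 2) ^ n := by
  have h : Real.exp (-(n : ℝ)) = Real.exp (-1) ^ n := by
    rw [← Real.exp_nat_mul]; simp
  rw [h]
  refine pow_le_pow_left₀ (Real.exp_pos _).le ?_ n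
  have := Real.exp_neg_one_lt_d9
  linarith

theorem driftRate_le : driftRate ≤ 1 / 1000 := by
  have := exp_neg_natCast_le 16
  rw [driftRate]
  norm_num at this ⊢
  linarith

/-- The numerical heart of the drift estimate at contention at least `8`. -/
theorem high_contention_bound {C : ℝ} (hC : 8 ≤ C) :
    Real.exp (-(15 / 16 * C)) + Real.exp (-(25 / 4)) + Real.exp (-(1 / 256 * C)) ≤
      Real.exp (-(driftRate * min C 1)) := by
  rw [min_eq_right (by linarith), mul_one]
  have h1 : Real.exp (-(15 / 16 * C)) ≤ (1 / 2) ^ 7 := by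
    refine le_trans (Real.exp_le_exp.2 ?_) (exp_neg_natCast_le 7)
    push_cast
    linarith
  have h2 : Real.exp (-(25 / 4)) ≤ (1 / 2) ^ 6 := by
    refine le_trans (Real.exp_le_exp.2 ?_) (exp_neg_natCast_le 6)
    push_cast
    linarith
  have h3 : Real.exp (-(1 / 256 * C)) ≤ 1 - 1 / 32 + 1 / 1024 := by
    refine le_trans (Real.exp_le_exp.2 (show _ ≤ -(1 / 32 : ℝ) by linarith)) ?_
    have := (abs_le.1 (Real.abs_exp_sub_one_sub_id_le (x := -(1 / 32))
      (by rw [abs_neg, abs_of_pos] <;> norm_num))).2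
    linarith
  have h4 := Real.one_sub_le_exp_neg driftRate
  have h5 := driftRate_le
  norm_num at h1 h2
  linarith

/-- The numerical heart of the drift estimate at contention at most `8`, where `P` is the
probability of silence. -/
theorem low_contention_bound {C P : ℝ} (hC0 : 0 ≤ C) (hC : C ≤ 8) (hP : Real.exp (-(2 * C)) ≤ P) :
    1 + P * Real.exp (1 / 8 * C) - P - (1 - Real.exp (-(25 / 4))) * (P * C) ≤
      Real.exp (-(driftRate * min C 1)) := by
  have hP0 : 0 < P := (Real.exp_pos _).trans_le hP
  have h1 : Real.exp (1 / 8 * C) ≤ 1 + 1 / 4 * C := by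
    have := (abs_le.1 (Real.abs_exp_sub_one_sub_id_le (x := 1 / 8 * C)
      (by rw [abs_of_nonneg] <;> linarith))).2
    nlinarith
  have h2 : Real.exp (-(25 / 4)) ≤ (1 / 2) ^ 6 := by
    refine le_trans (Real.exp_le_exp.2 ?_) (exp_neg_natCast_le 6)
    push_cast
    linarith
  have h3 : Real.exp (-16) ≤ P := (Real.exp_le_exp.2 (by linarith)).trans hP
  have h4 : driftRate * min C 1 ≤ driftRate * C :=
    mul_le_mul_of_nonneg_left (min_le_left _ _) driftRate_pos.le
  have h5 := Real.one_sub_le_exp_neg (driftRate * min C 1)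
  have h6 : driftRate * C ≤ P * C / 2 := by
    rw [driftRate]
    nlinarith
  have h7 : P * Real.exp (1 / 8 * C) ≤ P * (1 + 1 / 4 * C) :=
    mul_le_mul_of_nonneg_left h1 hP0.le
  have h8 : 0 ≤ P * C := by positivity
  norm_num at h2
  nlinarith

/-- The part `200 N + H` of the potential. -/
def Config.energy (σ : Config) : ℝ := 200 * σ.N + σ.H

section Drift

variable {c wmin : ℝ} {σ : Config}

theorem Config.resolve_window_sleep {jam : Bool} {act : ℕ → Action} {u : ℕ}
    (h : act u = .sleep) : (σ.resolve c wmin jam act).window u = σ.window u := by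
  simp [Config.resolve, h]

theorem Config.resolve_window_access {jam : Bool} {act : ℕ → Action} {u : ℕ}
    (h : act u ≠ .sleep) : (σ.resolve c wmin jam act).window u =
      newWindow c wmin (σ.window u) (σ.feedback jam act) := by
  simp [Config.resolve, h]

theorem Config.resolve_window_success {jam : Bool} {act : ℕ → Action} (u : ℕ)
    (h : σ.feedback jam act = .success) :
    (σ.resolve c wmin jam act).window u = σ.window u := by
  simp [Config.resolve, h, newWindow]

theorem Config.H_resolve_of_ne {jam : Bool} {act : ℕ → Action}
    (h : σ.feedback jam act ≠ .success) : (σ.resolve c wmin jam act).H - σ.H =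
      ∑ u ∈ σ.packets, (1 / Real.log ((σ.resolve c wmin jam act).window u) -
        1 / Real.log (σ.window u)) := by
  rw [Config.H, Config.H, Config.resolve_packets_of_ne h, Finset.sum_sub_distrib]

theorem Config.energy_resolve_of_ne {jam : Bool} {act : ℕ → Action}
    (h : σ.feedback jam act ≠ .success) :
    Real.exp (1 / 32 * ((σ.resolve c wmin jam act).energy - σ.energy)) =
      ∏ u ∈ σ.packets, Real.exp (1 / 32 *
        (1 / Real.log ((σ.resolve c wmin jam act).window u) - 1 / Real.log (σ.window u))) := by
  have hN : (σ.resolve c wmin jam act).N = σ.N := by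
    rw [Config.N, Config.N, Config.resolve_packets_of_ne h]
  rw [← Real.exp_sum, ← Finset.mul_sum, ← Config.H_resolve_of_ne h, Config.energy, Config.energy,
    hN]
  congr 2
  ring

theorem Config.feedback_jammed (act : ℕ → Action) : σ.feedback true act = .noisy := by
  simp [Config.feedback]

theorem Config.feedback_silent_iff {act : ℕ → Action} :
    σ.feedback false act = .silent ↔ ∀ u ∈ σ.packets, act u ≠ .send := by
  have h : (σ.senders act).card = 0 ↔ ∀ u ∈ σ.packets, act u ≠ .send := by
    rw [Finset.card_eq_zero, Config.senders, Finset.filter_eq_empty_iff]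
  rw [← h]
  unfold Config.feedback
  split_ifs <;> simp_all

theorem Config.feedback_success_iff {act : ℕ → Action} :
    σ.feedback false act = .success ↔
      ∃ u ∈ σ.packets, ∀ v ∈ σ.packets, (act v = .send ↔ v = u) := by
  have h : (σ.senders act).card = 1 ↔
      ∃ u ∈ σ.packets, ∀ v ∈ σ.packets, (act v = .send ↔ v = u) := by
    rw [Finset.card_eq_one]
    constructor
    · rintro ⟨u, hu⟩
      have h1 : ∀ v, v ∈ σ.packets ∧ act v = .send ↔ v = u := fun v => by
        simpa [Config.senders] using Finset.ext_iff.1 hu v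
      refine ⟨u, ((h1 u).2 rfl).1, fun v hv => ?_⟩
      rw [← h1 v]
      simp [hv]
    · rintro ⟨u, hu, h⟩
      refine ⟨u, Finset.ext fun v => ?_⟩
      rw [Config.senders, Finset.mem_filter, Finset.mem_singleton]
      constructor
      · rintro ⟨hv, h1⟩
        exact (h v hv).1 h1
      · rintro rfl
        exact ⟨hu, (h v hu).2 rfl⟩
  rw [← h]
  unfold Config.feedback
  split_ifs <;> simp_all

theorem Config.energy_resolve_success (h : LargeParams c wmin) (hσ : σ.Valid wmin) {jam : Bool}
    {act : ℕ → Action} (hf : σ.feedback jam act = .success) :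
    Real.exp (1 / 32 * ((σ.resolve c wmin jam act).energy - σ.energy)) ≤
      Real.exp (-(25 / 4)) := by
  have h1 := Config.resolve_N_of_success (c := c) (wmin := wmin) hf
  have h2 : (σ.resolve c wmin jam act).H ≤ σ.H := by
    rw [Config.H, Config.H]
    simp only [Config.resolve_window_success _ hf]
    refine Finset.sum_le_sum_of_subset_of_nonneg (Config.resolve_packets_subset jam act) ?_
    intro u hu _
    have := h.one_le_log (hσ u hu).2
    positivity
  rw [Config.energy, Config.energy, h1]
  exact Real.exp_le_exp.2 (by linarith)

/-- The factor by which a packet with the given action enters `exp ((200 N + H) / 32)` in a silent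
slot; `0` if the packet sends, as the slot is not silent then. -/
def silentFactor (c w : ℝ) : Action → ℝ
  | .sleep => 1
  | .listen => Real.exp (1 / 32 * (11 / 10 / (c * Real.log w ^ 3)))
  | .send => 0

/-- The factor by which a packet with the given action enters `exp ((200 N + H) / 32)` in a noisy
slot. -/
def noisyFactor (c w : ℝ) : Action → ℝ
  | .sleep => 1
  | _ => Real.exp (1 / 32 * -(1 / 3 / (c * Real.log w ^ 3)))

theorem silentFactor_nonneg (c w : ℝ) (x : Action) : 0 ≤ silentFactor c w x := by
  cases x <;> simp [silentFactor, Real.exp_nonneg]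

theorem noisyFactor_nonneg (c w : ℝ) (x : Action) : 0 ≤ noisyFactor c w x := by
  cases x <;> simp [noisyFactor, Real.exp_nonneg]

theorem LargeParams.noisyFactor_le_one {w : ℝ} (h : LargeParams c wmin) (hw : wmin ≤ w)
    (x : Action) : noisyFactor c w x ≤ 1 := by
  have h1 := h.one_le_log hw
  have h3 := h.hundred_le
  have h4 : 0 < 1 / 3 / (c * Real.log w ^ 3) := by positivity
  cases x <;> simp only [noisyFactor, le_refl]
  all_goals exact Real.exp_le_one_iff.2 (by linarith)

theorem Config.energy_resolve_silent (h : LargeParams c wmin) (hσ : σ.Valid wmin)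
    {act : ℕ → Action} (hf : σ.feedback false act = .silent) :
    Real.exp (1 / 32 * ((σ.resolve c wmin false act).energy - σ.energy)) ≤
      ∏ u ∈ σ.packets, silentFactor c (σ.window u) (act u) := by
  rw [Config.energy_resolve_of_ne (by simp [hf])]
  refine Finset.prod_le_prod (fun u _ => (Real.exp_pos _).le) fun u hu => ?_
  have hw := (hσ u hu).2
  have hns := Config.feedback_silent_iff.1 hf u hu
  cases hx : act u with
  | sleep => rw [Config.resolve_window_sleep hx]; simp [silentFactor]
  | listen =>
    rw [Config.resolve_window_access (by simp [hx]), hf, silentFactor]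
    exact Real.exp_le_exp.2 (mul_le_mul_of_nonneg_left (h.inv_log_silent_le hw) (by norm_num))
  | send => exact absurd hx hns

theorem Config.energy_resolve_noisy (h : LargeParams c wmin) (hσ : σ.Valid wmin) {jam : Bool}
    {act : ℕ → Action} (hf : σ.feedback jam act = .noisy) :
    Real.exp (1 / 32 * ((σ.resolve c wmin jam act).energy - σ.energy)) ≤
      ∏ u ∈ σ.packets, noisyFactor c (σ.window u) (act u) := by
  rw [Config.energy_resolve_of_ne (by simp [hf])]
  refine Finset.prod_le_prod (fun u _ => (Real.exp_pos _).le) fun u hu => ?_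
  have hw := (hσ u hu).2
  by_cases hx : act u = .sleep
  · rw [Config.resolve_window_sleep hx, hx]; simp [noisyFactor]
  · have h1 : noisyFactor c (σ.window u) (act u) =
        Real.exp (1 / 32 * -(1 / 3 / (c * Real.log (σ.window u) ^ 3))) := by
      cases hx' : act u <;> simp_all [noisyFactor]
    rw [Config.resolve_window_access hx, hf, h1]
    exact Real.exp_le_exp.2 (mul_le_mul_of_nonneg_left (h.inv_log_noisy_le hw) (by norm_num))

theorem Config.energy_resolve_noisy_le_one (h : LargeParams c wmin) (hσ : σ.Valid wmin)
    {jam : Bool} {act : ℕ → Action} (hf : σ.feedback jam act = .noisy) :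
    Real.exp (1 / 32 * ((σ.resolve c wmin jam act).energy - σ.energy)) ≤ 1 :=
  (Config.energy_resolve_noisy h hσ hf).trans
    (Finset.prod_le_one (fun _ _ => noisyFactor_nonneg _ _ _)
      fun u hu => h.noisyFactor_le_one (hσ u hu).2 _)

theorem Config.send_mem_Icc (h : LargeParams c wmin) (hσ : σ.Valid wmin) :
    ∀ u ∈ σ.packets, 0 ≤ 1 / σ.window u ∧ 1 / σ.window u ≤ 1 / 2 := fun u hu => by
  have := h.two_le (hσ u hu).2
  exact ⟨by positivity, one_div_le_one_div_of_le (by norm_num) this⟩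

theorem slotMean_silentFactor_le (h : LargeParams c wmin) (hσ : σ.Valid wmin) :
    slotMean c σ (fun act => ∏ u ∈ σ.packets, silentFactor c (σ.window u) (act u)) ≤
      ∏ u ∈ σ.packets, (1 - 15 / 16 * (1 / σ.window u)) := by
  rw [slotMean_prod c σ (fun u x => silentFactor c (σ.window u) x)]
  refine Finset.prod_le_prod (fun u _ => Finset.sum_nonneg fun x _ =>
    mul_nonneg (NNReal.coe_nonneg _) (silentFactor_nonneg _ _ _)) fun u hu => ?_
  rw [h.sum_actionProb_mul (hσ u hu).2]
  have := h.silent_factor_le (hσ u hu).2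
  simp only [silentFactor, mul_one, mul_zero, add_zero]
  exact this

theorem slotMean_noisyFactor_le (h : LargeParams c wmin) (hσ : σ.Valid wmin) :
    slotMean c σ (fun act => ∏ u ∈ σ.packets, noisyFactor c (σ.window u) (act u)) ≤
      ∏ u ∈ σ.packets, (1 - 1 / 256 * (1 / σ.window u)) := by
  rw [slotMean_prod c σ (fun u x => noisyFactor c (σ.window u) x)]
  refine Finset.prod_le_prod (fun u _ => Finset.sum_nonneg fun x _ =>
    mul_nonneg (NNReal.coe_nonneg _) (noisyFactor_nonneg _ _ _)) fun u hu => ?_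
  rw [h.sum_actionProb_mul (hσ u hu).2]
  have := h.noisy_factor_le (hσ u hu).2
  simp only [noisyFactor, mul_one]
  linarith

theorem slotMean_no_send (h : LargeParams c wmin) (hσ : σ.Valid wmin) :
    slotMean c σ (fun act => if ∀ u ∈ σ.packets, act u ≠ .send then 1 else 0) =
      ∏ u ∈ σ.packets, (1 - 1 / σ.window u) := by
  have := slotMean_prod c σ (fun _ x => if x ≠ .send then 1 else 0)
  simp only [Finset.prod_boole] at this
  rw [this]
  refine Finset.prod_congr rfl fun u hu => ?_
  rw [h.sum_actionProb_mul (hσ u hu).2]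
  simp

theorem slotMean_only_send (h : LargeParams c wmin) (hσ : σ.Valid wmin) {u : ℕ}
    (hu : u ∈ σ.packets) :
    slotMean c σ (fun act => if ∀ v ∈ σ.packets, (act v = .send ↔ v = u) then 1 else 0) =
      1 / σ.window u * ∏ v ∈ σ.packets.erase u, (1 - 1 / σ.window v) := by
  have := slotMean_prod c σ (fun v x => if (x = .send ↔ v = u) then 1 else 0)
  simp only [Finset.prod_boole] at this
  rw [this, ← Finset.mul_prod_erase _ _ hu]
  congr 1
  · rw [h.sum_actionProb_mul (hσ u hu).2]
    simp
  · refine Finset.prod_congr rfl fun v hv => ?_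
    rw [h.sum_actionProb_mul (hσ v (Finset.mem_of_mem_erase hv)).2]
    simp [Finset.ne_of_mem_erase hv]

/-- The number of packets that are the only sender: the indicator of success. -/
theorem Config.sum_only_send (act : ℕ → Action) :
    (∑ u ∈ σ.packets, if ∀ v ∈ σ.packets, (act v = .send ↔ v = u) then (1 : ℝ) else 0) =
      if σ.feedback false act = .success then 1 else 0 := by
  split_ifs with hf
  · obtain ⟨u, hu, h⟩ := Config.feedback_success_iff.1 hf
    rw [Finset.sum_eq_single_of_mem u hu, if_pos h]
    intro v hv hvu
    rw [if_neg]
    intro h'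
    exact hvu ((h v hv).1 ((h' v hv).2 rfl))
  · refine Finset.sum_eq_zero fun u hu => if_neg fun h => hf ?_
    exact Config.feedback_success_iff.2 ⟨u, hu, h⟩

/-- At high contention, the silent and successful slots are so rare, and the noisy ones decrease
`H` so much, that `exp ((200 N + H) / 32)` decreases in the mean. At low contention, a success is
far more valuable than the increase of `H` in a silent slot. -/
theorem slotMean_exp_energy_le (h : LargeParams c wmin) (hσ : σ.Valid wmin) :
    slotMean c σ (fun act =>
      Real.exp (1 / 32 * ((σ.resolve c wmin false act).energy - σ.energy))) ≤
      Real.exp (-(driftRate * min σ.contention 1)) := by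
  have hs := Config.send_mem_Icc h hσ
  have hC0 : 0 ≤ σ.contention := Finset.sum_nonneg fun u hu => (hs u hu).1
  rcases le_total 8 σ.contention with hC | hC
  · refine le_trans (slotMean_mono (G := fun act =>
      ∏ u ∈ σ.packets, silentFactor c (σ.window u) (act u) + Real.exp (-(25 / 4)) +
        ∏ u ∈ σ.packets, noisyFactor c (σ.window u) (act u)) fun act => ?_) ?_
    · have h1 : 0 ≤ ∏ u ∈ σ.packets, silentFactor c (σ.window u) (act u) :=
        Finset.prod_nonneg fun _ _ => silentFactor_nonneg _ _ _
      have h2 : 0 ≤ ∏ u ∈ σ.packets, noisyFactor c (σ.window u) (act u) :=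
        Finset.prod_nonneg fun _ _ => noisyFactor_nonneg _ _ _
      have h3 := Real.exp_pos (-(25 / 4))
      cases hf : σ.feedback false act with
      | silent => linarith [Config.energy_resolve_silent h hσ hf]
      | success => linarith [Config.energy_resolve_success h hσ hf]
      | noisy => linarith [Config.energy_resolve_noisy h hσ hf]
    · rw [slotMean_add, slotMean_add, slotMean_const]
      refine le_trans ?_ (high_contention_bound hC)
      gcongr
      · exact (slotMean_silentFactor_le h hσ).trans (prod_one_sub_mul_le_exp hs (by norm_num))
      · exact (slotMean_noisyFactor_le h hσ).trans (prod_one_sub_mul_le_exp hs (by norm_num))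
  · refine le_trans (slotMean_mono (G := fun act =>
      1 + ∏ u ∈ σ.packets, silentFactor c (σ.window u) (act u) +
        (-1) * (if ∀ u ∈ σ.packets, act u ≠ .send then 1 else 0) +
        (-(1 - Real.exp (-(25 / 4)))) * ∑ u ∈ σ.packets,
          if ∀ v ∈ σ.packets, (act v = .send ↔ v = u) then (1 : ℝ) else 0) fun act => ?_) ?_
    · have h1 : 0 ≤ ∏ u ∈ σ.packets, silentFactor c (σ.window u) (act u) :=
        Finset.prod_nonneg fun _ _ => silentFactor_nonneg _ _ _
      rw [Config.sum_only_send]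
      cases hf : σ.feedback false act with
      | silent =>
        rw [if_pos (Config.feedback_silent_iff.1 hf), if_neg (by simp)]
        linarith [Config.energy_resolve_silent h hσ hf]
      | success =>
        rw [if_neg, if_pos rfl]
        · linarith [Config.energy_resolve_success h hσ hf]
        · rw [← Config.feedback_silent_iff, hf]
          simp
      | noisy =>
        rw [if_neg, if_neg (by simp)]
        · linarith [Config.energy_resolve_noisy_le_one h hσ hf]
        · rw [← Config.feedback_silent_iff, hf]
          simp
    · rw [slotMean_add, slotMean_add, slotMean_add, slotMean_const, slotMean_const_mul,
        slotMean_const_mul, slotMean_sum, slotMean_no_send h hσ,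
        Finset.sum_congr rfl fun u hu => slotMean_only_send h hσ hu]
      refine le_trans ?_ (low_contention_bound hC0 hC (exp_le_prod_one_sub hs))
      have h1 := (slotMean_silentFactor_le h hσ).trans (prod_le_prod_one_sub_mul_exp hs)
      have h2 := prod_mul_sum_le hs
      have h3 : Real.exp (-(25 / 4)) ≤ 1 := Real.exp_le_one_iff.2 (by norm_num)
      have h4 := mul_le_mul_of_nonneg_left h2 (sub_nonneg.2 h3)
      unfold Config.contention at *
      linarith

theorem slotMean_exp_energy_jammed_le (h : LargeParams c wmin) (hσ : σ.Valid wmin) :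
    slotMean c σ (fun act =>
      Real.exp (1 / 32 * ((σ.resolve c wmin true act).energy - σ.energy))) ≤ 1 := by
  refine (slotMean_mono fun act => ?_).trans_eq (slotMean_const c σ 1)
  exact Config.energy_resolve_noisy_le_one h hσ (Config.feedback_jammed act)

end Drift

/-- The contention of a slot, cut off at `1`, and summed over the history. -/
def totalContention (wmin : ℝ) (l : List SlotRecord) : ℝ :=
  (l.map fun r => min (r.before.inject wmin r.arrivals).contention 1).sum

theorem totalContention_append (wmin : ℝ) (l : List SlotRecord) (r : SlotRecord) :
    totalContention wmin (l ++ [r]) =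
      totalContention wmin l + min (r.before.inject wmin r.arrivals).contention 1 := by
  simp [totalContention]

/-- The exponential supermartingale that controls `200 N + H`: arrivals and jammed slots are paid
for by the term `201 (A + J)`. -/
def energyProcess (wmin y₀ : ℝ) (past : List SlotRecord) (σ : Config) : ℝ :=
  Real.exp (1 / 32 * (σ.energy - y₀ - 201 * (totalArrivals past + totalJammed past)) +
    driftRate * totalContention wmin past)

theorem slotMean_energyProcess_le {c wmin : ℝ} (h : LargeParams c wmin) (y₀ : ℝ)
    {past : List SlotRecord} {σ : Config} (hσ : σ.Valid wmin) (a : ℕ) (jam : Bool) :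
    slotMean c (σ.inject wmin a) (fun act =>
      energyProcess wmin y₀ (past ++ [⟨σ, a, jam, act⟩]) (σ.slotEnd c wmin a jam act)) ≤
      energyProcess wmin y₀ past σ := by
  set ρ := σ.inject wmin a with hρ
  have hv : ρ.Valid wmin := Config.inject_valid hσ a
  set m := min ρ.contention 1 with hm
  have hE : ρ.energy ≤ σ.energy + 201 * a := by
    have h1 := Config.inject_N hσ a
    have h2 := Config.inject_H hσ a
    have h3 : 1 / Real.log wmin ≤ 1 := by
      have := h.one_le_log le_rfl
      exact (div_le_one (by linarith)).2 this
    have h4 : (a : ℝ) * (1 / Real.log wmin) ≤ a * 1 :=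
      mul_le_mul_of_nonneg_left h3 (Nat.cast_nonneg a)
    rw [Config.energy, Config.energy, hρ, h1, h2]
    linarith
  set j : ℝ := if jam then 1 else 0 with hj
  have h1 : ∀ act, energyProcess wmin y₀ (past ++ [⟨σ, a, jam, act⟩])
      (σ.slotEnd c wmin a jam act) =
      Real.exp (1 / 32 * (ρ.energy - y₀ - 201 * (totalArrivals past + totalJammed past + a + j)) +
        driftRate * (totalContention wmin past + m)) *
      Real.exp (1 / 32 * ((ρ.resolve c wmin jam act).energy - ρ.energy)) := by
    intro act
    rw [energyProcess, totalArrivals_append, totalJammed_append, totalContention_append,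
      ← Real.exp_add]
    congr 1
    dsimp only
    rw [← hρ, ← hm, ← hj]
    ring
  simp only [h1]
  rw [slotMean_const_mul]
  have h2 : slotMean c ρ (fun act =>
      Real.exp (1 / 32 * ((ρ.resolve c wmin jam act).energy - ρ.energy))) ≤
      Real.exp (-(driftRate * m) + j) := by
    have hm1 : m ≤ 1 := min_le_right _ _
    cases jam with
    | false => simpa [hj] using slotMean_exp_energy_le h hv
    | true =>
      refine (slotMean_exp_energy_jammed_le h hv).trans (Real.one_le_exp ?_)
      have : driftRate * m ≤ driftRate * 1 := mul_le_mul_of_nonneg_left hm1 driftRate_pos.le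
      simp only [hj, if_true]
      linarith [driftRate_le]
  refine (mul_le_mul_of_nonneg_left h2 (Real.exp_pos _).le).trans ?_
  rw [← Real.exp_add, energyProcess]
  refine Real.exp_le_exp.2 ?_
  have hj0 : 0 ≤ j := by rw [hj]; split_ifs <;> norm_num
  linarith

/-! ### Drift of the window sizes -/

/-- The weight `(max {w, W / e} / W) ^ (c ln W)` of a window of size `w`, where `W = e ^ x`. -/
def windowWeight (c x w : ℝ) : ℝ := Real.exp (c * x * max (Real.log w - x) (-1))

/-- The listening rate of a packet with window size `e ^ x`. -/
def stdRate (c x : ℝ) : ℝ := c * x ^ 3 / Real.exp x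

theorem windowWeight_nonneg (c x w : ℝ) : 0 ≤ windowWeight c x w := (Real.exp_pos _).le

section Weights

variable {c wmin w x : ℝ}

theorem stdRate_pos (hc : 0 < c) (hx : 0 < x) : 0 < stdRate c x := by
  unfold stdRate; positivity

theorem LargeParams.listenRate_eq (h : LargeParams c wmin) (hw : wmin ≤ w) :
    listenRate c w = c * Real.log w ^ 3 / Real.exp (Real.log w) := by
  rw [Real.exp_log (by linarith [h.two_le hw]), listenRate]

/-- Windows larger than `e ^ x` make a packet listen less. -/
theorem LargeParams.listenRate_le_stdRate (h : LargeParams c wmin) (hw : wmin ≤ w) (hx : 100 ≤ x)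
    (hwx : x - 1 ≤ Real.log w) : listenRate c w ≤ 3 * stdRate c x := by
  rw [h.listenRate_eq hw, stdRate]
  have hc := h.hundred_le
  set y := Real.log w
  have hx0 : 0 < x := by linarith
  have h1 : y ≤ x * Real.exp (y / x - 1) := by
    have := Real.add_one_le_exp (y / x - 1)
    calc y = x * (y / x - 1 + 1) := by field_simp; ring
      _ ≤ _ := by gcongr
  have h2 : y ^ 3 ≤ x ^ 3 * Real.exp (3 * (y / x - 1)) := by
    have h3 : Real.exp (3 * (y / x - 1)) = Real.exp (y / x - 1) ^ 3 := by
      rw [← Real.exp_nat_mul]; norm_num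
    rw [h3, ← mul_pow]
    exact pow_le_pow_left₀ (by linarith) h1 3
  have h4 : 3 * (y / x - 1) - y ≤ 1 - x := by
    have h5 : 3 * (y / x - 1) = (y - x) * (3 / x) := by field_simp
    have h6 : 3 / x ≤ 3 / 100 := div_le_div_of_nonneg_left (by norm_num) (by norm_num) hx
    have h7 : 0 < 3 / x := by positivity
    rw [h5]
    nlinarith
  have h8 : Real.exp (3 * (y / x - 1)) / Real.exp y ≤ 3 / Real.exp x := by
    rw [← Real.exp_sub]
    refine (Real.exp_le_exp.2 h4).trans ?_
    rw [Real.exp_sub]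
    gcongr
    linarith [Real.exp_one_lt_d9]
  calc c * y ^ 3 / Real.exp y ≤ c * (x ^ 3 * Real.exp (3 * (y / x - 1))) / Real.exp y := by gcongr
    _ = c * x ^ 3 * (Real.exp (3 * (y / x - 1)) / Real.exp y) := by ring
    _ ≤ c * x ^ 3 * (3 / Real.exp x) := by gcongr
    _ = _ := by ring

theorem LargeParams.stdRate_le_listenRate (h : LargeParams c wmin) (hw : wmin ≤ w) (hx : 100 ≤ x)
    (hwx : x - 1 ≤ Real.log w) (hwx' : Real.log w ≤ x + 1) :
    stdRate c x ≤ 4 * listenRate c w := by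
  rw [h.listenRate_eq hw, stdRate]
  have hc := h.hundred_le
  set y := Real.log w
  have h1 : Real.exp y ≤ Real.exp x * (272 / 100) := by
    refine (Real.exp_le_exp.2 hwx').trans ?_
    rw [Real.exp_add]
    gcongr
    linarith [Real.exp_one_lt_d9]
  have h2 : (99 / 100 * x) ^ 3 ≤ y ^ 3 := pow_le_pow_left₀ (by linarith) (by linarith) 3
  rw [div_le_iff₀ (Real.exp_pos x), mul_div_assoc', div_mul_eq_mul_div, le_div_iff₀ (Real.exp_pos y)]
  have h3 : x ^ 3 * (272 / 100) ≤ 4 * y ^ 3 := by nlinarith [show 0 ≤ x ^ 3 by positivity]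
  calc c * x ^ 3 * Real.exp y ≤ c * x ^ 3 * (Real.exp x * (272 / 100)) := by gcongr
    _ = c * (x ^ 3 * (272 / 100)) * Real.exp x := by ring
    _ ≤ c * (4 * y ^ 3) * Real.exp x := by gcongr
    _ = _ := by ring

/-- A single update multiplies the weight by at most `e ^ (x / ln w)`. -/
theorem LargeParams.windowWeight_newWindow_le (h : LargeParams c wmin) (hw : wmin ≤ w)
    (hx : 0 ≤ x) (f : Feedback) :
    windowWeight c x (newWindow c wmin w f) ≤
      windowWeight c x w * Real.exp (x / Real.log w) := by
  have hc := h.hundred_le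
  have hy := h.one_le_log hw
  have hcy := h.mul_log_ge hw
  have h0 : 0 ≤ 1 / (c * Real.log w) := by positivity
  have h1 : Real.log (newWindow c wmin w f) ≤ Real.log w + 1 / (c * Real.log w) := by
    cases f with
    | silent =>
      rw [h.log_newWindow_silent hw]
      have h2 : 0 ≤ Real.log (1 + 1 / (c * Real.log w)) := Real.log_nonneg (by linarith)
      refine max_le (by linarith) ?_
      have := Real.log_le_log (by linarith [h.two_le le_rfl]) hw
      linarith
    | success => rw [newWindow]; linarith
    | noisy =>
      rw [h.log_newWindow_noisy hw]
      linarith [log_one_add_le_self h0]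
  rw [windowWeight, windowWeight, ← Real.exp_add]
  refine Real.exp_le_exp.2 ?_
  have h3 : max (Real.log (newWindow c wmin w f) - x) (-1) ≤
      max (Real.log w - x) (-1) + 1 / (c * Real.log w) := by
    refine max_le ?_ ?_
    · linarith [le_max_left (Real.log w - x) (-1)]
    · linarith [le_max_right (Real.log w - x) (-1)]
  have h4 : c * x * (1 / (c * Real.log w)) = x / Real.log w := by
    field_simp
  rw [← h4, ← mul_add]
  exact mul_le_mul_of_nonneg_left h3 (by positivity)

theorem windowWeight_of_le (hwx : Real.log w ≤ x - 1) :
    windowWeight c x w = Real.exp (-(c * x)) := by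
  rw [windowWeight, max_eq_right (by linarith)]
  ring_nf

theorem LargeParams.windowWeight_newWindow_le_three (h : LargeParams c wmin) (hw : wmin ≤ w)
    (hx : 100 ≤ x) (hwx : x - 1 ≤ Real.log w) (f : Feedback) :
    windowWeight c x (newWindow c wmin w f) ≤ 3 * windowWeight c x w := by
  refine (h.windowWeight_newWindow_le hw (by linarith) f).trans ?_
  rw [mul_comm]
  refine mul_le_mul_of_nonneg_right ?_ (windowWeight_nonneg _ _ _)
  have h1 : x / Real.log w ≤ 1 + 1 / 50 := by
    rw [div_le_iff₀ (by linarith)]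
    linarith
  refine (Real.exp_le_exp.2 h1).trans ?_
  rw [Real.exp_add]
  have h2 : Real.exp (1 / 50) ≤ 1 + 1 / 50 + (1 / 50) ^ 2 := by
    have := (abs_le.1 (Real.abs_exp_sub_one_sub_id_le (x := 1 / 50)
      (by rw [abs_of_pos] <;> norm_num))).2
    linarith
  have h3 := Real.exp_one_lt_d9
  nlinarith [Real.exp_pos 1]

theorem LargeParams.windowWeight_silent_le (h : LargeParams c wmin) (hw : wmin ≤ w)
    (hx : 100 ≤ x) (hx' : Real.log wmin ≤ x - 1) (hwx : x - 1 ≤ Real.log w)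
    (hwx' : Real.log w ≤ x + 1) :
    windowWeight c x (newWindow c wmin w .silent) ≤
      3 / 4 * windowWeight c x w + Real.exp (-(c * x)) := by
  have hc := h.hundred_le
  have hy := h.one_le_log hw
  have hcy := h.mul_log_ge hw
  rw [windowWeight, h.log_newWindow_silent hw, windowWeight,
    max_eq_left (show -1 ≤ Real.log w - x by linarith)]
  have hd := half_le_log_one_add (show 0 ≤ 1 / (c * Real.log w) by positivity)
    ((div_le_one (by linarith)).2 (by linarith))
  set d := Real.log (1 + 1 / (c * Real.log w))
  set y := Real.log w
  have h1 : max (max (y - d) (Real.log wmin) - x) (-1) = max (y - d - x) (-1) := by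
    rcases le_total (y - d) (Real.log wmin) with h2 | h2
    · rw [max_eq_right h2, max_eq_right (by linarith), max_eq_right (by linarith)]
    · rw [max_eq_left h2]
  rw [h1]
  have hcx : 0 < c * x := by positivity
  have h3 : Real.exp (c * x * (y - d - x)) ≤ 3 / 4 * Real.exp (c * x * (y - x)) := by
    have h4 : c * x * (y - d - x) = c * x * (y - x) - c * x * d := by ring
    have h5 : 1 / 3 ≤ c * x * d := by
      have h6 : c * x * (1 / (c * y) / 2) = x / (2 * y) := by field_simp
      have h7 : 1 / 3 ≤ x / (2 * y) := by
        rw [div_le_div_iff₀ (by norm_num) (by linarith)]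
        linarith
      calc 1 / 3 ≤ c * x * (1 / (c * y) / 2) := by rw [h6]; exact h7
        _ ≤ _ := by gcongr
    have h8 : 4 / 3 ≤ Real.exp (c * x * d) := by
      linarith [Real.add_one_le_exp (c * x * d)]
    rw [h4, Real.exp_sub, div_le_iff₀ (Real.exp_pos _)]
    have := Real.exp_pos (c * x * (y - x))
    nlinarith
  rcases le_total (y - d - x) (-1) with h9 | h9
  · rw [max_eq_right h9]
    have := Real.exp_pos (c * x * (y - x))
    rw [mul_neg_one]
    linarith
  · rw [max_eq_left h9]
    linarith [Real.exp_pos (-(c * x))]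

end Weights

theorem one_sub_sum_le_prod {ι : Type*} {t : Finset ι} {s : ι → ℝ}
    (hs : ∀ i ∈ t, 0 ≤ s i ∧ s i ≤ 1) : 1 - ∑ i ∈ t, s i ≤ ∏ i ∈ t, (1 - s i) := by
  classical
  induction t using Finset.induction_on with
  | empty => simp
  | insert a t ha ih =>
    rw [Finset.sum_insert ha, Finset.prod_insert ha]
    have h1 := hs a (Finset.mem_insert_self _ _)
    have h2 : ∀ i ∈ t, 0 ≤ s i ∧ s i ≤ 1 := fun i hi => hs i (Finset.mem_insert_of_mem hi)
    have h3 := ih h2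
    have h4 : 0 ≤ ∑ i ∈ t, s i := Finset.sum_nonneg fun i hi => (h2 i hi).1
    nlinarith [mul_le_mul_of_nonneg_left h3 (sub_nonneg.2 h1.2), mul_nonneg h1.1 h4]

section PacketDrift

variable {c wmin x : ℝ} {σ : Config}

/-- The probability that packet `u` listens and no packet sends. -/
theorem slotMean_listen_no_send (h : LargeParams c wmin) (hσ : σ.Valid wmin) {u : ℕ}
    (hu : u ∈ σ.packets) :
    slotMean c σ (fun act => if ∀ v ∈ σ.packets, (act v ≠ .send ∧ (v = u → act v = .listen))
      then 1 else 0) =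
      (listenRate c (σ.window u) - 1 / σ.window u) *
        ∏ v ∈ σ.packets.erase u, (1 - 1 / σ.window v) := by
  have := slotMean_prod c σ (fun v x => if (x ≠ .send ∧ (v = u → x = .listen)) then 1 else 0)
  simp only [Finset.prod_boole] at this
  rw [this, ← Finset.mul_prod_erase _ _ hu]
  congr 1
  · rw [h.sum_actionProb_mul (hσ u hu).2]
    simp
  · refine Finset.prod_congr rfl fun v hv => ?_
    rw [h.sum_actionProb_mul (hσ v (Finset.mem_of_mem_erase hv)).2]
    simp [Finset.ne_of_mem_erase hv]

/-- Given that packet `u` listens, the slot is silent unless another packet, or `u` itself,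
sends. -/
theorem le_listen_no_send (h : LargeParams c wmin) (hσ : σ.Valid wmin) {u : ℕ}
    (hu : u ∈ σ.packets) :
    listenRate c (σ.window u) * (1 - (min σ.contention 1 + 1 / 100)) ≤
      (listenRate c (σ.window u) - 1 / σ.window u) *
        ∏ v ∈ σ.packets.erase u, (1 - 1 / σ.window v) := by
  have hw := (hσ u hu).2
  have hs := Config.send_mem_Icc h hσ
  have hs' : ∀ v ∈ σ.packets.erase u, 0 ≤ 1 / σ.window v ∧ 1 / σ.window v ≤ 1 := fun v hv => by
    have := hs v (Finset.mem_of_mem_erase hv)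
    exact ⟨this.1, by linarith [this.2]⟩
  have h1 := one_sub_sum_le_prod hs'
  have h2 : 0 ≤ ∏ v ∈ σ.packets.erase u, (1 - 1 / σ.window v) :=
    Finset.prod_nonneg fun v hv => by linarith [hs' v hv]
  have h3 : ∑ v ∈ σ.packets.erase u, 1 / σ.window v ≤ σ.contention :=
    Finset.sum_le_sum_of_subset_of_nonneg (Finset.erase_subset _ _) fun v hv _ => (hs v hv).1
  set p := ∏ v ∈ σ.packets.erase u, (1 - 1 / σ.window v)
  have hm0 : 0 ≤ min σ.contention 1 :=
    le_min (Finset.sum_nonneg fun v hv => (hs v hv).1) zero_le_one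
  have hm1 : min σ.contention 1 ≤ 1 := min_le_right _ _
  have h4 : 1 - min σ.contention 1 ≤ p := by
    rcases min_choice σ.contention 1 with h5 | h5 <;> rw [h5] <;> linarith
  have h5 := h.listenRate_mul hw 1
  have h6 : 1 / (c * Real.log (σ.window u) ^ 3) ≤ 1 / 100 := by
    refine one_div_le_one_div_of_le (by norm_num) ?_
    have : 1 ≤ Real.log (σ.window u) ^ 3 := one_le_pow₀ (h.one_le_log hw)
    nlinarith [h.hundred_le]
  have h7 := h.listenRate_pos hw
  have h8 : 1 / σ.window u ≤ listenRate c (σ.window u) * (1 / 100) := by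
    rw [one_mul] at h5
    rw [← h5]
    exact mul_le_mul_of_nonneg_left h6 h7.le
  set l := listenRate c (σ.window u)
  calc l * (1 - (min σ.contention 1 + 1 / 100))
      ≤ (l * (99 / 100)) * (1 - min σ.contention 1) := by nlinarith [mul_nonneg h7.le hm0]
    _ ≤ (l - 1 / σ.window u) * p := by
        refine mul_le_mul (by linarith) h4 (by linarith) ?_
        nlinarith

/-- The weight of packet `u` after a slot, `0` if the packet has left. -/
def Config.weightAfter (c wmin x : ℝ) (σ : Config) (jam : Bool) (u : ℕ) (act : ℕ → Action) : ℝ :=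
  if u ∈ (σ.resolve c wmin jam act).packets then
    windowWeight c x ((σ.resolve c wmin jam act).window u) else 0

theorem Config.weightAfter_sleep (jam : Bool) {u : ℕ} {act : ℕ → Action} (hs : act u = .sleep) :
    σ.weightAfter c wmin x jam u act ≤ windowWeight c x (σ.window u) := by
  unfold Config.weightAfter
  rw [Config.resolve_window_sleep hs]
  split_ifs
  · exact le_rfl
  · exact windowWeight_nonneg _ _ _

theorem Config.weightAfter_access (jam : Bool) {u : ℕ} {act : ℕ → Action} (hs : act u ≠ .sleep) :
    σ.weightAfter c wmin x jam u act ≤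
      windowWeight c x (newWindow c wmin (σ.window u) (σ.feedback jam act)) := by
  unfold Config.weightAfter
  rw [Config.resolve_window_access hs]
  split_ifs
  · exact le_rfl
  · exact windowWeight_nonneg _ _ _

/-- The mean growth of the weight of a packet with any window of size at least `e ^ (x - 1)`. -/
theorem slotMean_weightAfter_le_add (h : LargeParams c wmin) (hσ : σ.Valid wmin)
    (hx : 100 ≤ x) {u : ℕ} (hu : u ∈ σ.packets) (hwx : x - 1 ≤ Real.log (σ.window u))
    (jam : Bool) :
    slotMean c σ (σ.weightAfter c wmin x jam u) ≤
      windowWeight c x (σ.window u) * (1 + 2 * listenRate c (σ.window u)) := by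
  have hw := (hσ u hu).2
  set f := windowWeight c x (σ.window u)
  refine (slotMean_mono (G := fun act => (fun y => if y = .sleep then f else 3 * f) (act u))
    fun act => ?_).trans_eq ?_
  · dsimp only
    split_ifs with hs
    · exact Config.weightAfter_sleep jam hs
    · exact (Config.weightAfter_access jam hs).trans
        (h.windowWeight_newWindow_le_three hw hx hwx _)
  · rw [slotMean_single hu (fun y => if y = .sleep then f else 3 * f), h.sum_actionProb_mul hw]
    simp
    ring

/-- The mean growth of the weight of a packet with a window of size within a factor `e` of
`e ^ x`, in a slot that is not jammed. -/
theorem slotMean_weightAfter_unjammed_le (h : LargeParams c wmin) (hσ : σ.Valid wmin)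
    (hx : 100 ≤ x) (hx' : Real.log wmin ≤ x - 1) {u : ℕ} (hu : u ∈ σ.packets)
    (hwx : x - 1 ≤ Real.log (σ.window u)) (hwx' : Real.log (σ.window u) ≤ x + 1) :
    slotMean c σ (σ.weightAfter c wmin x false u) ≤
      windowWeight c x (σ.window u) * (1 + listenRate c (σ.window u) *
        (9 / 4 * min σ.contention 1 - 9 / 40)) + Real.exp (-(c * x)) := by
  have hw := (hσ u hu).2
  have hf0 := windowWeight_nonneg c x (σ.window u)
  set f := windowWeight c x (σ.window u)
  set e := Real.exp (-(c * x)) with he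
  have he0 : 0 < e := Real.exp_pos _
  refine (slotMean_mono (G := fun act =>
    (fun y => if y = .sleep then f else 3 * f) (act u) + (e - 9 / 4 * f) *
      if ∀ v ∈ σ.packets, (act v ≠ .send ∧ (v = u → act v = .listen)) then 1 else 0)
    fun act => ?_).trans ?_
  · dsimp only
    split_ifs with hs hq hq
    · exact absurd ((hq u hu).2 rfl) (by simp [hs])
    · rw [mul_zero, add_zero]
      exact Config.weightAfter_sleep _ hs
    · have hfb : σ.feedback false act = .silent :=
        Config.feedback_silent_iff.2 fun v hv => (hq v hv).1
      refine (Config.weightAfter_access _ hs).trans ?_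
      rw [hfb]
      refine (h.windowWeight_silent_le hw hx hx' hwx hwx').trans (le_of_eq ?_)
      ring
    · rw [mul_zero, add_zero]
      exact (Config.weightAfter_access _ hs).trans
        (h.windowWeight_newWindow_le_three hw hx hwx _)
  · rw [slotMean_add, slotMean_const_mul, slotMean_listen_no_send h hσ hu,
      slotMean_single hu (fun y => if y = .sleep then f else 3 * f), h.sum_actionProb_mul hw]
    have h1 := le_listen_no_send h hσ hu
    have h2 : (listenRate c (σ.window u) - 1 / σ.window u) *
        ∏ v ∈ σ.packets.erase u, (1 - 1 / σ.window v) ≤ 1 := by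
      have hs := Config.send_mem_Icc h hσ
      have h3 := h.listenRate_le_one hw
      have h4 := h.one_div_le_listenRate hw
      have h5 := (hs u hu).1
      refine mul_le_one₀ (by linarith) (Finset.prod_nonneg fun v hv => ?_)
        (Finset.prod_le_one (fun v hv => ?_) fun v hv => ?_) <;>
      linarith [hs v (Finset.mem_of_mem_erase hv)]
    set q := (listenRate c (σ.window u) - 1 / σ.window u) *
        ∏ v ∈ σ.packets.erase u, (1 - 1 / σ.window v)
    set l := listenRate c (σ.window u)
    have h3 : e * q ≤ e * 1 := mul_le_mul_of_nonneg_left h2 he0.le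
    have h4 := mul_le_mul_of_nonneg_left h1 hf0
    have h5 := mul_nonneg hf0 (h.listenRate_pos hw).le
    simp only [if_true, reduceCtorEq, if_false]
    nlinarith

/-- The drift of the logarithm of the weight in a slot, in terms of the contention `C`, of `j`,
which is `1` in jammed slots, and of `b`, which is `1` if there are unusually large windows. -/
def driftBound (c x C j b : ℝ) : ℝ := stdRate c x * (7 * (min C 1 + j + b) - 1 / 32)

theorem slotMean_weightAfter_le (h : LargeParams c wmin) (hσ : σ.Valid wmin)
    (hx : 100 ≤ x) (hx' : Real.log wmin ≤ x - 1) {u : ℕ} (hu : u ∈ σ.packets) (jam : Bool) {b : ℝ}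
    (hb0 : 0 ≤ b) (hb : x + 1 < Real.log (σ.window u) → 1 ≤ b) :
    slotMean c σ (σ.weightAfter c wmin x jam u) ≤
      Real.exp (driftBound c x σ.contention (if jam then 1 else 0) b) *
        windowWeight c x (σ.window u) + Real.exp (x - c * x) := by
  have hw := (hσ u hu).2
  have hc := h.hundred_le
  have hf0 := windowWeight_nonneg c x (σ.window u)
  have hm0 : 0 ≤ min σ.contention 1 :=
    le_min (Finset.sum_nonneg fun v hv => (Config.send_mem_Icc h hσ v hv).1) zero_le_one
  have hl := h.listenRate_pos hw
  have hS : 0 < stdRate c x := stdRate_pos (by linarith) (by linarith)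
  set j : ℝ := if jam then 1 else 0 with hj
  have hj0 : 0 ≤ j := by rw [hj]; split_ifs <;> norm_num
  rcases le_total (Real.log (σ.window u)) (x - 1) with hwx | hwx
  · have h1 : slotMean c σ (σ.weightAfter c wmin x jam u) ≤ Real.exp (x - c * x) := by
      refine (slotMean_mono fun act => ?_).trans_eq (slotMean_const c σ (Real.exp (x - c * x)))
      have h2 : windowWeight c x (σ.window u) * Real.exp (x / Real.log (σ.window u)) ≤
          Real.exp (x - c * x) := by
        rw [windowWeight_of_le hwx, ← Real.exp_add]
        refine Real.exp_le_exp.2 ?_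
        have := div_le_self (show 0 ≤ x by linarith) (h.one_le_log hw)
        linarith
      refine le_trans ?_ h2
      by_cases hs : act u = .sleep
      · refine (Config.weightAfter_sleep jam hs).trans (le_mul_of_one_le_right hf0 ?_)
        have := h.one_le_log hw
        exact Real.one_le_exp (by positivity)
      · exact (Config.weightAfter_access jam hs).trans
          (h.windowWeight_newWindow_le hw (by linarith) _)
    have h3 := mul_nonneg (Real.exp_pos (driftBound c x σ.contention j b)).le hf0
    linarith
  · have h3 := h.listenRate_le_stdRate hw hx hwx
    have hexp : Real.exp (-(c * x)) ≤ Real.exp (x - c * x) := Real.exp_le_exp.2 (by linarith)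
    have hE := Real.add_one_le_exp (driftBound c x σ.contention j b)
    by_cases hbig : 1 ≤ j + b
    · have h4 : 2 * listenRate c (σ.window u) ≤ driftBound c x σ.contention j b := by
        unfold driftBound
        have : 7 * 1 - 1 / 32 ≤ 7 * (min σ.contention 1 + j + b) - 1 / 32 := by linarith
        nlinarith [mul_le_mul_of_nonneg_left this hS.le]
      have h5 := slotMean_weightAfter_le_add h hσ hx hu hwx jam
      have h6 : windowWeight c x (σ.window u) * (1 + 2 * listenRate c (σ.window u)) ≤
          windowWeight c x (σ.window u) * Real.exp (driftBound c x σ.contention j b) :=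
        mul_le_mul_of_nonneg_left (by linarith) hf0
      linarith [Real.exp_pos (x - c * x)]
    · have hjam : jam = false := by
        cases jam
        · rfl
        · exact absurd (by simp only [hj, if_true]; linarith) hbig
      have hwx' : Real.log (σ.window u) ≤ x + 1 := by
        by_contra! hcon
        exact hbig (by linarith [hb hcon])
      have h4 := h.stdRate_le_listenRate hw hx hwx hwx'
      have h5 := slotMean_weightAfter_unjammed_le h hσ hx hx' hu hwx hwx'
      have h6 : listenRate c (σ.window u) * (9 / 4 * min σ.contention 1 - 9 / 40) ≤
          driftBound c x σ.contention j b := by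
        unfold driftBound
        nlinarith [mul_le_mul_of_nonneg_right h3 hm0, mul_nonneg hS.le hb0,
          mul_nonneg hS.le hj0, mul_nonneg hS.le hm0]
      have h7 : windowWeight c x (σ.window u) * (1 + listenRate c (σ.window u) *
          (9 / 4 * min σ.contention 1 - 9 / 40)) ≤
          windowWeight c x (σ.window u) * Real.exp (driftBound c x σ.contention j b) :=
        mul_le_mul_of_nonneg_left (by linarith) hf0
      rw [hjam]
      linarith

end PacketDrift

open Classical in
/-- The indicator that some window is larger than `e ^ (x + 1)`. -/
def Config.oversize (x : ℝ) (σ : Config) : ℝ :=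
  if ∃ u ∈ σ.packets, x + 1 < Real.log (σ.window u) then 1 else 0

/-- The drift bound of the slot with the given record. -/
def SlotRecord.drift (c wmin x : ℝ) (r : SlotRecord) : ℝ :=
  driftBound c x (r.before.inject wmin r.arrivals).contention (if r.jammed then 1 else 0)
    (r.before.oversize x)

/-- The drift bounds, summed over the history. -/
def totalDrift (c wmin x : ℝ) (l : List SlotRecord) : ℝ := (l.map (SlotRecord.drift c wmin x)).sum

/-- The total weight of the windows, compensated for the drift, and divided by the number of
packets that have ever been in the system, which makes it insensitive to arrivals. -/
def windowProcess (c wmin x n₀ : ℝ) (past : List SlotRecord) (σ : Config) : ℝ :=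
  Real.exp (-totalDrift c wmin x past) * (∑ u ∈ σ.packets, windowWeight c x (σ.window u)) /
    (n₀ + totalArrivals past)

theorem Config.oversize_nonneg (x : ℝ) (σ : Config) : 0 ≤ σ.oversize x := by
  unfold Config.oversize; split_ifs <;> norm_num

theorem Config.oversize_le_one (x : ℝ) (σ : Config) : σ.oversize x ≤ 1 := by
  unfold Config.oversize; split_ifs <;> norm_num

section WindowDrift

variable {c wmin x : ℝ}

theorem Config.contention_nonneg (h : LargeParams c wmin) {σ : Config} (hσ : σ.Valid wmin) :
    0 ≤ σ.contention :=
  Finset.sum_nonneg fun v hv => (Config.send_mem_Icc h hσ v hv).1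

theorem windowProcess_nonneg {n₀ : ℝ} (hn₀ : 0 ≤ n₀) (past : List SlotRecord) (σ : Config) :
    0 ≤ windowProcess c wmin x n₀ past σ :=
  div_nonneg (mul_nonneg (Real.exp_pos _).le
    (Finset.sum_nonneg fun _ _ => windowWeight_nonneg _ _ _))
    (add_nonneg hn₀ (totalArrivals_nonneg _))

theorem totalDrift_append (l : List SlotRecord) (r : SlotRecord) :
    totalDrift c wmin x (l ++ [r]) = totalDrift c wmin x l + r.drift c wmin x := by
  simp [totalDrift]

/-- One step of the window process. The lower bound on the compensator is assumed here, as it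
holds as long as the past is not too long. -/
theorem slotMean_windowProcess_le (h : LargeParams c wmin) (hx : 100 ≤ x)
    (hx' : Real.log wmin ≤ x - 1) {n₀ : ℝ} (hn₀ : 0 < n₀) {past : List SlotRecord} {σ : Config}
    (hI : RunInv wmin n₀ past σ) (a : ℕ) (jam : Bool) {k : ℝ}
    (hk : -totalDrift c wmin x past ≤ k)
    (hk' : ∀ act, -totalDrift c wmin x (past ++ [⟨σ, a, jam, act⟩]) ≤ k) :
    slotMean c (σ.inject wmin a) (fun act =>
      windowProcess c wmin x n₀ (past ++ [⟨σ, a, jam, act⟩]) (σ.slotEnd c wmin a jam act)) ≤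
      windowProcess c wmin x n₀ past σ + 2 * Real.exp (k + x - c * x) := by
  set ρ := σ.inject wmin a with hρ
  have hσ := hI.valid
  have hv : ρ.Valid wmin := Config.inject_valid hσ a
  set B := totalDrift c wmin x past with hB
  set b := driftBound c x ρ.contention (if jam then 1 else 0) (σ.oversize x) with hb
  set M := n₀ + totalArrivals past + a with hM
  have hA := totalArrivals_nonneg past
  have ha : (0 : ℝ) ≤ a := Nat.cast_nonneg a
  have hM0 : 0 < M := by rw [hM]; linarith
  have hBb : ∀ act, totalDrift c wmin x (past ++ [⟨σ, a, jam, act⟩]) = B + b := fun act => by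
    rw [totalDrift_append]; rfl
  have hkb : -(B + b) ≤ k := by
    have := hk' fun _ => .sleep
    rwa [hBb] at this
  have h1 : ∀ act, windowProcess c wmin x n₀ (past ++ [⟨σ, a, jam, act⟩])
      (σ.slotEnd c wmin a jam act) =
      (Real.exp (-(B + b)) / M) * ∑ u ∈ ρ.packets, ρ.weightAfter c wmin x jam u act := by
    intro act
    rw [windowProcess, hBb, totalArrivals_append, ← add_assoc, ← hM, mul_div_right_comm]
    congr 1
    unfold Config.weightAfter
    rw [← Finset.sum_filter]
    refine Finset.sum_congr ?_ fun _ _ => rfl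
    ext u
    rw [Finset.mem_filter]
    exact ⟨fun hu => ⟨Config.resolve_packets_subset _ _ hu, hu⟩, fun hu => hu.2⟩
  simp only [h1]
  rw [slotMean_const_mul, slotMean_sum]
  have h2 : ∀ u ∈ ρ.packets, slotMean c ρ (ρ.weightAfter c wmin x jam u) ≤
      Real.exp b * windowWeight c x (ρ.window u) + Real.exp (x - c * x) := by
    intro u hu
    refine slotMean_weightAfter_le h hv hx hx' hu jam (Config.oversize_nonneg _ _) fun hlarge => ?_
    have hu' : u ∈ σ.packets ∪ Finset.Ico σ.fresh (σ.fresh + a) := hu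
    rcases Finset.mem_union.1 hu' with hu1 | hu1
    · rw [hρ, Config.inject_window_of_mem hσ a hu1] at hlarge
      rw [Config.oversize, if_pos ⟨u, hu1, hlarge⟩]
    · rw [hρ, Config.inject_window_of_new a hu1] at hlarge
      linarith
  have h3 : ∑ u ∈ ρ.packets, slotMean c ρ (ρ.weightAfter c wmin x jam u) ≤
      Real.exp b * (∑ u ∈ σ.packets, windowWeight c x (σ.window u) + a * Real.exp (-(c * x))) +
        M * Real.exp (x - c * x) := by
    refine (Finset.sum_le_sum h2).trans ?_
    rw [Finset.sum_add_distrib, ← Finset.mul_sum, Config.sum_inject hσ a, windowWeight_of_le hx',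
      Finset.sum_const, nsmul_eq_mul]
    have h4 : (ρ.packets.card : ℝ) ≤ M := by
      have h5 := Config.inject_N hσ a
      have h6 := hI.N_le
      change ρ.N ≤ M
      rw [hρ, h5, hM]
      linarith
    have := mul_le_mul_of_nonneg_right h4 (Real.exp_pos (x - c * x)).le
    linarith
  set S := ∑ u ∈ σ.packets, windowWeight c x (σ.window u) with hS
  have hS0 : 0 ≤ S := Finset.sum_nonneg fun _ _ => windowWeight_nonneg _ _ _
  refine (mul_le_mul_of_nonneg_left h3 (by positivity)).trans ?_
  have h5 : Real.exp (-(B + b)) / M * (Real.exp b * (S + a * Real.exp (-(c * x))) +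
      M * Real.exp (x - c * x)) = Real.exp (-B) * S / M +
        Real.exp (-B) * Real.exp (-(c * x)) * (a / M) +
        Real.exp (-(B + b)) * Real.exp (x - c * x) := by
    have h6 : Real.exp (-B) = Real.exp (-(B + b)) * Real.exp b := by
      rw [← Real.exp_add]; congr 1; ring
    rw [h6]
    field_simp
  rw [h5]
  have h7 : Real.exp (-B) * S / M ≤ windowProcess c wmin x n₀ past σ := by
    rw [windowProcess, ← hB, ← hS]
    exact div_le_div_of_nonneg_left (by positivity) (by linarith) (by linarith)
  have h8 : Real.exp (-B) * Real.exp (-(c * x)) * (a / M) ≤ Real.exp (k + x - c * x) := by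
    have h9 : (a : ℝ) / M ≤ 1 := (div_le_one hM0).2 (by linarith)
    refine (mul_le_of_le_one_right (by positivity) h9).trans ?_
    rw [← Real.exp_add]
    exact Real.exp_le_exp.2 (by linarith)
  have h9 : Real.exp (-(B + b)) * Real.exp (x - c * x) ≤ Real.exp (k + x - c * x) := by
    rw [← Real.exp_add]
    exact Real.exp_le_exp.2 (by linarith)
  linarith

end WindowDrift

/-! ### Consequences of a small window process -/

section History

variable {c wmin x : ℝ}

theorem neg_totalDrift_le (h : LargeParams c wmin) (hx : 100 ≤ x) {l : List SlotRecord}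
    (hl : ∀ r ∈ l, r.before.Valid wmin) :
    -totalDrift c wmin x l ≤ stdRate c x * l.length / 32 := by
  have hS : 0 < stdRate c x := stdRate_pos (by linarith [h.hundred_le]) (by linarith)
  induction l with
  | nil => simp [totalDrift]
  | cons r l ih =>
    have h1 := ih fun s hs => hl s (List.mem_cons_of_mem _ hs)
    have h2 : -(stdRate c x / 32) ≤ r.drift c wmin x := by
      have h3 := Config.contention_nonneg h
        (Config.inject_valid (hl r List.mem_cons_self) r.arrivals)
      have h4 : 0 ≤ min (r.before.inject wmin r.arrivals).contention 1 := le_min h3 zero_le_one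
      have h5 := Config.oversize_nonneg x r.before
      have h6 : (0 : ℝ) ≤ if r.jammed then 1 else 0 := by split_ifs <;> norm_num
      have h7 := mul_nonneg hS.le (add_nonneg (add_nonneg h4 h6) h5)
      unfold SlotRecord.drift driftBound
      linarith
    simp only [totalDrift, List.map_cons, List.sum_cons, List.length_cons] at h1 ⊢
    push_cast
    linarith

theorem totalDrift_le (h : LargeParams c wmin) (hx : 100 ≤ x) (l : List SlotRecord) :
    totalDrift c wmin x l ≤ 21 * (stdRate c x * l.length) := by
  have hS : 0 < stdRate c x := stdRate_pos (by linarith [h.hundred_le]) (by linarith)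
  induction l with
  | nil => simp [totalDrift]
  | cons r l ih =>
    have h2 : r.drift c wmin x ≤ 21 * stdRate c x := by
      have h4 : min (r.before.inject wmin r.arrivals).contention 1 ≤ 1 := min_le_right _ _
      have h5 := Config.oversize_le_one x r.before
      have h6 : (if r.jammed then 1 else 0 : ℝ) ≤ 1 := by split_ifs <;> norm_num
      unfold SlotRecord.drift driftBound
      nlinarith
    simp only [totalDrift, List.map_cons, List.sum_cons, List.length_cons] at ih ⊢
    push_cast
    linarith

theorem totalDrift_eq {l : List SlotRecord} (hl : ∀ r ∈ l, r.before.oversize x = 0) :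
    totalDrift c wmin x l =
      stdRate c x * (7 * (totalContention wmin l + totalJammed l) - l.length / 32) := by
  induction l with
  | nil => simp [totalDrift, totalContention, totalJammed]
  | cons r l ih =>
    have h1 := ih fun s hs => hl s (List.mem_cons_of_mem _ hs)
    have h2 : totalJammed (r :: l) = totalJammed l + if r.jammed then 1 else 0 := by
      cases hj : r.jammed <;> simp [totalJammed, hj]
    rw [h2]
    simp only [totalDrift, totalContention, List.map_cons, List.sum_cons, List.length_cons,
      SlotRecord.drift, driftBound, hl r List.mem_cons_self] at h1 ⊢
    rw [h1]
    push_cast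
    ring

theorem totalContention_eq_length {l : List SlotRecord}
    (hl : ∀ r ∈ l, 1 ≤ (r.before.inject wmin r.arrivals).contention) :
    totalContention wmin l = l.length := by
  induction l with
  | nil => simp [totalContention]
  | cons r l ih =>
    have h1 := ih fun s hs => hl s (List.mem_cons_of_mem _ hs)
    simp only [totalContention, List.map_cons, List.sum_cons, List.length_cons] at h1 ⊢
    rw [h1, min_eq_right (hl r List.mem_cons_self)]
    push_cast
    ring

theorem totalContention_nonneg (h : LargeParams c wmin) {l : List SlotRecord}
    (hl : ∀ r ∈ l, r.before.Valid wmin) : 0 ≤ totalContention wmin l := by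
  refine List.sum_nonneg fun y hy => ?_
  obtain ⟨r, hr, rfl⟩ := List.mem_map.1 hy
  exact le_min (Config.contention_nonneg h (Config.inject_valid (hl r hr) _)) zero_le_one

theorem totalArrivals_le (l : List SlotRecord) (r : SlotRecord) (rest : List SlotRecord) :
    totalArrivals l ≤ totalArrivals (l ++ r :: rest) := by
  simp only [totalArrivals, List.map_append, List.sum_append]
  exact_mod_cast Nat.le_add_right _ _

end History

/-- The relations between the parameters of the interval. The scale `W = e ^ x` is such that
`W / ln² W = cτ τ`; for `τ` as in the theorem, all windows at the beginning are at most `W`. -/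
structure Scale (c wmin cτ γ τ x : ℝ) : Prop where
  large : LargeParams c wmin
  hundred_le : 100 ≤ x
  log_wmin_le : Real.log wmin ≤ x - 1
  le_cτ : 200 ≤ cτ
  one_le_γ : 1 ≤ γ
  le_c : 128 * cτ * (γ + 3) ≤ c
  exp_eq : Real.exp x / x ^ 2 = cτ * τ
  one_le_τ : 1 ≤ τ

/-- The event that the run has the right length and that the window process stays below
`τ ^ γ`. -/
def WindowsControlled (c wmin γ τ x n₀ : ℝ) (e : List SlotRecord × Config) : Prop :=
  e.1.length = ⌈τ⌉₊ ∧
    AlongRun (fun l ρ => RunInv wmin n₀ l ρ ∧ windowProcess c wmin x n₀ l ρ < τ ^ γ) e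

namespace Scale

variable {c wmin cτ γ τ x n₀ : ℝ} {e : List SlotRecord × Config}

theorem stdRate_mul (s : Scale c wmin cτ γ τ x) : stdRate c x * τ = c * x / cτ := by
  have h1 := s.exp_eq
  have h2 := s.hundred_le
  have h3 := s.le_cτ
  have h4 : τ = Real.exp x / x ^ 2 / cτ := by rw [h1]; field_simp
  rw [h4, stdRate]
  field_simp

theorem τ_le (s : Scale c wmin cτ γ τ x) : τ ≤ Real.exp x := by
  have h1 := s.exp_eq
  have h2 := s.hundred_le
  have h3 := s.le_cτ
  have h4 := s.one_le_τ
  have h5 : Real.exp x / x ^ 2 ≤ Real.exp x :=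
    div_le_self (Real.exp_pos x).le (by nlinarith)
  nlinarith

theorem ceil_le (s : Scale c wmin cτ γ τ x) : (⌈τ⌉₊ : ℝ) ≤ 2 * τ := by
  have h4 := s.one_le_τ
  have := (Nat.ceil_lt_add_one (show 0 ≤ τ by linarith)).le
  linarith

theorem rate_mul_ceil_le (s : Scale c wmin cτ γ τ x) :
    stdRate c x * ⌈τ⌉₊ ≤ 2 * (c * x / cτ) := by
  have hS : 0 < stdRate c x :=
    stdRate_pos (by linarith [s.large.hundred_le]) (by linarith [s.hundred_le])
  rw [← s.stdRate_mul]
  nlinarith [mul_le_mul_of_nonneg_left s.ceil_le hS.le]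

/-- The probability that the windows are not controlled. -/
theorem measure_windows_le (s : Scale c wmin cτ γ τ x) (adv : Adversary) {σ : Config}
    (hσ : σ.Valid wmin) (hne : σ.packets.Nonempty)
    (hw : ∀ u ∈ σ.packets, Real.log (σ.window u) ≤ x) :
    (run c wmin adv ⌈τ⌉₊ [] σ).toOuterMeasure {e | ¬ WindowsControlled c wmin γ τ x σ.N e} ≤
      ENNReal.ofReal (2 / τ ^ γ) := by
  have h := s.large
  have hc := h.hundred_le
  have hx := s.hundred_le
  have hcτ := s.le_cτ
  have hτ := s.one_le_τ
  have hS : 0 < stdRate c x := stdRate_pos (by linarith) (by linarith)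
  have hN : 0 < σ.N := by
    rw [Config.N]
    exact_mod_cast Finset.card_pos.2 hne
  set k := stdRate c x * ⌈τ⌉₊ / 32 with hk
  have hlen : ∀ l : List SlotRecord, (∀ r ∈ l, r.before.Valid wmin) → l.length ≤ ⌈τ⌉₊ →
      -totalDrift c wmin x l ≤ k := fun l hl hl' => by
    refine (neg_totalDrift_le h hx hl).trans ?_
    rw [hk]
    have : (l.length : ℝ) ≤ ⌈τ⌉₊ := Nat.cast_le.2 hl'
    gcongr
  have hmax := run_maximal (c := c) (wmin := wmin) (adv := adv) (T := ⌈τ⌉₊)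
    (ε := 2 * Real.exp (k + x - c * x)) (r := τ ^ γ) (by positivity) (by positivity)
    (Inv := RunInv wmin σ.N) (V := windowProcess c wmin x σ.N)
    (fun past ρ => windowProcess_nonneg hN.le past ρ)
    (fun past ρ act hI => hI.next h _ _ act)
    (fun past ρ hI hl => by
      refine slotMean_windowProcess_le h hx s.log_wmin_le hN hI _ _
        (hlen past hI.past_valid hl.le) fun act => hlen _ ?_ ?_
      · exact (hI.next h _ _ act).past_valid
      · rw [List.length_append, List.length_singleton]
        omega)
    ⌈τ⌉₊ [] σ (by simp)
    ⟨hσ, by simp [totalArrivals], by simp, by simp⟩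
    (fun l r rest hl => by simp at hl)
  simp only [List.length_nil, zero_add] at hmax
  refine hmax.trans (ENNReal.ofReal_le_ofReal ?_)
  refine div_le_div_of_nonneg_right ?_ (by positivity)
  have h1 : windowProcess c wmin x σ.N [] σ ≤ 1 := by
    simp only [windowProcess, totalDrift, totalArrivals, List.map_nil, List.sum_nil, neg_zero,
      Real.exp_zero, one_mul, Nat.cast_zero, add_zero]
    rw [div_le_one hN]
    calc _ ≤ ∑ u ∈ σ.packets, (1 : ℝ) := by
          refine Finset.sum_le_sum fun u hu => Real.exp_le_one_iff.2 ?_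
          refine mul_nonpos_of_nonneg_of_nonpos (by positivity) (max_le ?_ (by norm_num))
          linarith [hw u hu]
      _ = σ.N := by simp [Config.N]
  have h2 : (⌈τ⌉₊ : ℝ) * (2 * Real.exp (k + x - c * x)) ≤ 1 := by
    have h3 : k ≤ c * x / 16 := by
      have h4 := s.rate_mul_ceil_le
      have h5 : c * x / cτ ≤ c * x := div_le_self (by positivity) (by linarith)
      rw [hk]
      linarith
    have h6 : Real.exp (k + x - c * x) ≤ Real.exp (-x - x) :=
      Real.exp_le_exp.2 (by nlinarith)
    have h7 : (⌈τ⌉₊ : ℝ) ≤ 2 * Real.exp x := s.ceil_le.trans (by linarith [s.τ_le])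
    have h8 : Real.exp (-x - x) * Real.exp x = Real.exp (-x) := by
      rw [← Real.exp_add]; congr 1; ring
    have h9 : Real.exp (-x) ≤ 1 / 4 := by
      rw [Real.exp_neg, ← one_div]
      refine one_div_le_one_div_of_le (by norm_num) ?_
      linarith [Real.add_one_le_exp x]
    calc (⌈τ⌉₊ : ℝ) * (2 * Real.exp (k + x - c * x))
        ≤ 2 * Real.exp x * (2 * Real.exp (-x - x)) := by gcongr
      _ = 4 * (Real.exp (-x - x) * Real.exp x) := by ring
      _ ≤ 1 := by rw [h8]; linarith
  linarith

/-- The bound for single windows that a small window process gives. -/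
theorem log_window_le (s : Scale c wmin cτ γ τ x) (hn₀ : 0 < n₀) {l : List SlotRecord}
    {ρ : Config} (hl : windowProcess c wmin x n₀ l ρ < τ ^ γ) {u : ℕ} (hu : u ∈ ρ.packets) :
    c * x * (Real.log (ρ.window u) - x) ≤
      γ * x + totalDrift c wmin x l + Real.log (n₀ + totalArrivals l) := by
  have hM : 0 < n₀ + totalArrivals l := by linarith [totalArrivals_nonneg l]
  have hcx : 0 < c * x := mul_pos (by linarith [s.large.hundred_le]) (by linarith [s.hundred_le])
  have h1 : windowWeight c x (ρ.window u) ≤ ∑ v ∈ ρ.packets, windowWeight c x (ρ.window v) :=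
    Finset.single_le_sum (f := fun v => windowWeight c x (ρ.window v))
      (fun v _ => windowWeight_nonneg _ _ _) hu
  have h2 : Real.exp (c * x * (Real.log (ρ.window u) - x)) ≤ windowWeight c x (ρ.window u) :=
    Real.exp_le_exp.2 (mul_le_mul_of_nonneg_left (le_max_left _ _) hcx.le)
  have h3 : τ ^ γ ≤ Real.exp (γ * x) := by
    have : Real.exp (γ * x) = Real.exp x ^ γ := by rw [← Real.exp_mul, mul_comm]
    rw [this]
    exact Real.rpow_le_rpow (by linarith [s.one_le_τ]) s.τ_le (by linarith [s.one_le_γ])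
  rw [windowProcess, div_lt_iff₀ hM] at hl
  have h4 : Real.exp (-totalDrift c wmin x l) *
      Real.exp (c * x * (Real.log (ρ.window u) - x)) ≤
      Real.exp (γ * x) * Real.exp (Real.log (n₀ + totalArrivals l)) := by
    rw [Real.exp_log hM]
    calc _ ≤ _ := mul_le_mul_of_nonneg_left (h2.trans h1) (Real.exp_pos _).le
      _ ≤ _ := hl.le
      _ ≤ _ := by gcongr
  rw [← Real.exp_add, ← Real.exp_add, Real.exp_le_exp] at h4
  linarith

theorem drift_le (s : Scale c wmin cτ γ τ x) {l : List SlotRecord} (hl : l.length ≤ ⌈τ⌉₊) :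
    totalDrift c wmin x l ≤ 1 / 4 * (c * x) := by
  have hS : 0 < stdRate c x :=
    stdRate_pos (by linarith [s.large.hundred_le]) (by linarith [s.hundred_le])
  have h1 := totalDrift_le s.large s.hundred_le l
  have h2 : (l.length : ℝ) ≤ ⌈τ⌉₊ := Nat.cast_le.2 hl
  have h3 := mul_le_mul_of_nonneg_left h2 hS.le
  have h4 := s.rate_mul_ceil_le
  have hcx : 0 < c * x := mul_pos (by linarith [s.large.hundred_le]) (by linarith [s.hundred_le])
  have h5 : c * x / cτ ≤ c * x / 200 :=
    div_le_div_of_nonneg_left hcx.le (by norm_num) s.le_cτ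
  linarith

theorem log_add_le (s : Scale c wmin cτ γ τ x) (hn₀ : 0 < n₀) (hn : n₀ ≤ Real.exp (2 * x))
    {A : ℝ} (hA0 : 0 ≤ A) (hA : A ≤ Real.exp (2 * x)) : Real.log (n₀ + A) ≤ 3 * x := by
  rw [Real.log_le_iff_le_exp (by linarith)]
  have h1 : Real.exp (3 * x) = Real.exp x * Real.exp (2 * x) := by
    rw [← Real.exp_add]; congr 1; ring
  have h2 : 2 ≤ Real.exp x := by linarith [Real.add_one_le_exp x, s.hundred_le]
  rw [h1]
  nlinarith [Real.exp_pos (2 * x)]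

theorem mul_le_cx (s : Scale c wmin cτ γ τ x) : (γ + 3) * x ≤ c * x * (1 / (128 * cτ)) := by
  have h1 := s.le_c
  have h2 := s.le_cτ
  have h3 := s.hundred_le
  have h4 : γ + 3 ≤ c * (1 / (128 * cτ)) := by
    rw [mul_one_div, le_div_iff₀ (by linarith)]
    linarith
  nlinarith

/-- As long as the arrivals are polynomial in the scale, no window gets larger than `e W`. -/
theorem log_window_le_add_one (s : Scale c wmin cτ γ τ x) (hn₀ : 0 < n₀)
    (hn : n₀ ≤ Real.exp (2 * x)) {l : List SlotRecord} {ρ : Config} (hlen : l.length ≤ ⌈τ⌉₊)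
    (hl : windowProcess c wmin x n₀ l ρ < τ ^ γ) (hA : totalArrivals l ≤ Real.exp (2 * x))
    {u : ℕ} (hu : u ∈ ρ.packets) : Real.log (ρ.window u) ≤ x + 1 := by
  have h1 := s.log_window_le hn₀ hl hu
  have h2 := s.drift_le hlen
  have h3 := s.log_add_le hn₀ hn (totalArrivals_nonneg l) hA
  have h4 := s.mul_le_cx
  have hcx : 0 < c * x := mul_pos (by linarith [s.large.hundred_le]) (by linarith [s.hundred_le])
  have h5 : 1 / (128 * cτ) ≤ 1 / 4 :=
    one_div_le_one_div_of_le (by norm_num) (by linarith [s.le_cτ])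
  have h6 := mul_le_mul_of_nonneg_left h5 hcx.le
  have h7 : c * x * (Real.log (ρ.window u) - x) ≤ c * x * 1 := by linarith
  have := le_of_mul_le_mul_left h7 hcx
  linarith

/-- If there are more than `W ^ 2` arrivals, then their number exceeds all windows. -/
theorem window_le_arrivals (s : Scale c wmin cτ γ τ x) (hn₀ : 0 < n₀)
    (hn : n₀ ≤ Real.exp (2 * x)) {l : List SlotRecord} {ρ : Config} (hlen : l.length ≤ ⌈τ⌉₊)
    (hv : ρ.Valid wmin)
    (hl : windowProcess c wmin x n₀ l ρ < τ ^ γ) (hA : Real.exp (2 * x) < totalArrivals l)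
    {u : ℕ} (hu : u ∈ ρ.packets) : ρ.window u ≤ totalArrivals l := by
  have hx := s.hundred_le
  have hA0 : 0 < totalArrivals l := (Real.exp_pos _).trans hA
  have h1 := s.log_window_le hn₀ hl hu
  have h2 := s.drift_le hlen
  have h3 : Real.log (n₀ + totalArrivals l) ≤ 1 + Real.log (totalArrivals l) := by
    rw [Real.log_le_iff_le_exp (by linarith), Real.exp_add, Real.exp_log hA0]
    nlinarith [Real.add_one_le_exp 1]
  have h4 := s.mul_le_cx
  have hcx : 10000 ≤ c * x := by nlinarith [s.large.hundred_le]
  have h5 : 1 / (128 * cτ) ≤ 1 / 4 :=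
    one_div_le_one_div_of_le (by norm_num) (by linarith [s.le_cτ])
  have h6 := mul_le_mul_of_nonneg_left h5 (show 0 ≤ c * x by linarith)
  have h7 : 2 * x < Real.log (totalArrivals l) := by
    rwa [Real.lt_log_iff_exp_lt hA0]
  set a := Real.log (totalArrivals l)
  have h8 : c * x * (Real.log (ρ.window u) - x) ≤ c * x * (1 + a / 4) := by
    nlinarith
  have h9 := le_of_mul_le_mul_left h8 (by linarith)
  have h10 : 2 ≤ ρ.window u := s.large.two_le (hv u hu).2
  rw [← Real.log_le_log_iff (by linarith) hA0]
  linarith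

theorem record_length_le {l rest : List SlotRecord} {r : SlotRecord}
    (he : WindowsControlled c wmin γ τ x n₀ e) (h : e.1 = l ++ r :: rest) :
    l.length ≤ ⌈τ⌉₊ := by
  rw [← he.1, h, List.length_append]
  exact Nat.le_add_right _ _

theorem log_window_record_le (s : Scale c wmin cτ γ τ x) (hn₀ : 0 < n₀)
    (hn : n₀ ≤ Real.exp (2 * x)) (he : WindowsControlled c wmin γ τ x n₀ e)
    (hA : totalArrivals e.1 ≤ Real.exp (2 * x)) {r : SlotRecord} (hr : r ∈ e.1) :
    ∀ u ∈ r.before.packets, Real.log (r.before.window u) ≤ x + 1 := by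
  obtain ⟨l, rest, hl⟩ := List.append_of_mem hr
  have h1 := he.2.2 l r rest hl
  intro u hu
  refine s.log_window_le_add_one hn₀ hn (record_length_le he hl) h1.2 ?_ hu
  refine (totalArrivals_le l r rest).trans ?_
  rwa [← hl]

/-- If the contention is low in most slots, and few slots are jammed, then all windows at the end
are smaller than `W`, by a factor that depends on `cτ` only. -/
theorem log_window_le_sub (s : Scale c wmin cτ γ τ x) (hn₀ : 0 < n₀)
    (hn : n₀ ≤ Real.exp (2 * x)) (he : WindowsControlled c wmin γ τ x n₀ e)
    (hA : totalArrivals e.1 ≤ Real.exp (2 * x))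
    (hlow : 7 * (totalContention wmin e.1 + totalJammed e.1) ≤ τ / 64)
    {u : ℕ} (hu : u ∈ e.2.packets) : Real.log (e.2.window u) ≤ x - 1 / (128 * cτ) := by
  have h1 := s.log_window_le hn₀ he.2.1.2 hu
  have h2 : totalDrift c wmin x e.1 ≤ -(c * x * (2 * (1 / (128 * cτ)))) := by
    rw [totalDrift_eq fun r hr => ?_]
    · have hS : 0 < stdRate c x :=
        stdRate_pos (by linarith [s.large.hundred_le]) (by linarith [s.hundred_le])
      have h3 : τ ≤ e.1.length := by rw [he.1]; exact Nat.le_ceil τ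
      have h4 : 7 * (totalContention wmin e.1 + totalJammed e.1) - e.1.length / 32 ≤
          -(τ / 64) := by linarith
      have h5 : stdRate c x * -(τ / 64) = -(c * x * (2 * (1 / (128 * cτ)))) := by
        have h6 := s.stdRate_mul
        have h7 : stdRate c x * -(τ / 64) = -(stdRate c x * τ) / 64 := by ring
        have h8 := s.le_cτ
        rw [h7, h6]
        field_simp
        ring
      rw [← h5]
      exact mul_le_mul_of_nonneg_left h4 hS.le
    · rw [Config.oversize, if_neg]
      rintro ⟨v, hv, hv'⟩
      linarith [s.log_window_record_le hn₀ hn he hA hr v hv]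
  have h3 := s.log_add_le hn₀ hn (totalArrivals_nonneg e.1) hA
  have h4 := s.mul_le_cx
  have hcx : 0 < c * x := mul_pos (by linarith [s.large.hundred_le]) (by linarith [s.hundred_le])
  have h7 : c * x * (Real.log (e.2.window u) - x) ≤ c * x * -(1 / (128 * cτ)) := by linarith
  have := le_of_mul_le_mul_left h7 hcx
  linarith

/-- If the number of packets determines the length of the interval, then the contention is at
least `1` throughout the interval. -/
theorem totalContention_eq (s : Scale c wmin cτ γ τ x) (hn₀ : n₀ = (cτ * τ) ^ 2)
    (he : WindowsControlled c wmin γ τ x n₀ e)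
    (hA : totalArrivals e.1 ≤ Real.exp (2 * x)) : totalContention wmin e.1 = e.1.length := by
  have hx := s.hundred_le
  have hE : Real.exp (2 * x) = Real.exp x * Real.exp x := by
    rw [← Real.exp_add]; congr 1; ring
  have hpos : 0 < n₀ := by
    rw [hn₀, ← s.exp_eq]
    positivity
  have hn : n₀ ≤ Real.exp (2 * x) := by
    rw [hn₀, ← s.exp_eq, div_pow, hE, ← sq]
    exact div_le_self (by positivity) (one_le_pow₀ (by nlinarith))
  have hexp : 10 * x ^ 4 ≤ Real.exp x := by
    have h1 := Real.pow_div_factorial_le_exp x (by linarith) 6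
    have h2 : (Nat.factorial 6 : ℝ) = 720 := by norm_num [Nat.factorial]
    rw [h2] at h1
    have h3 : 0 ≤ x ^ 4 := by positivity
    nlinarith [mul_le_mul_of_nonneg_left (show 10000 ≤ x ^ 2 by nlinarith) h3]
  refine totalContention_eq_length fun r hr => ?_
  obtain ⟨l, rest, hl⟩ := List.append_of_mem hr
  have h1 := (he.2.2 l r rest hl).1
  have h2 := s.log_window_record_le hpos hn he hA hr
  set ρ := r.before.inject wmin r.arrivals with hρ
  have hv := Config.inject_valid h1.valid r.arrivals
  have h3 : ∀ u ∈ ρ.packets, Real.exp (-(x + 1)) ≤ 1 / ρ.window u := by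
    intro u hu
    have hw := s.large.two_le (hv u hu).2
    rw [Real.exp_neg, ← one_div]
    refine one_div_le_one_div_of_le (by linarith) ?_
    rw [← Real.log_le_iff_le_exp (by linarith)]
    have hu' : u ∈ r.before.packets ∪ Finset.Ico r.before.fresh (r.before.fresh + r.arrivals) := hu
    rcases Finset.mem_union.1 hu' with hu1 | hu1
    · rw [hρ, Config.inject_window_of_mem h1.valid _ hu1]
      exact h2 u hu1
    · rw [hρ, Config.inject_window_of_new _ hu1]
      linarith [s.log_wmin_le]
  have h4 : ρ.N * Real.exp (-(x + 1)) ≤ ρ.contention := by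
    have := Finset.sum_le_sum h3
    rwa [Finset.sum_const, nsmul_eq_mul] at this
  refine le_trans ?_ h4
  have h5 : Real.exp (x + 1) ≤ ρ.N := by
    have h6 := Config.inject_N h1.valid r.arrivals
    have h7 := h1.le_N
    have h8 : (l.length : ℝ) ≤ 2 * τ :=
      le_trans (Nat.cast_le.2 (record_length_le he hl)) s.ceil_le
    have h9 := s.τ_le
    have h10 : (0 : ℝ) ≤ r.arrivals := Nat.cast_nonneg _
    have h11 : 10 * Real.exp x ≤ n₀ := by
      rw [hn₀, ← s.exp_eq, div_pow, ← pow_mul, le_div_iff₀ (by positivity), sq]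
      norm_num
      linarith [mul_le_mul_of_nonneg_left hexp (Real.exp_pos x).le]
    have h12 : Real.exp (x + 1) ≤ 3 * Real.exp x := by
      rw [Real.exp_add]
      nlinarith [Real.exp_pos x, Real.exp_one_lt_d9]
    rw [hρ, h6]
    linarith [Real.exp_pos x]
  rw [Real.exp_neg, ← div_eq_mul_inv, le_div_iff₀ (Real.exp_pos _), one_mul]
  exact h5

end Scale

/-! ### The decrease of the potential -/

theorem exp_div_sq_lt {y z : ℝ} (hy : 2 ≤ y) (hyz : y < z) :
    Real.exp y / y ^ 2 < Real.exp z / z ^ 2 := by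
  have hy0 : 0 < y := by linarith
  have hz0 : 0 < z := by linarith
  have h1 : z / y < Real.exp (z / y - 1) := by
    have h2 : z / y - 1 ≠ 0 := by
      rw [sub_ne_zero, Ne, div_eq_one_iff_eq hy0.ne']
      exact hyz.ne'
    linarith [Real.add_one_lt_exp h2]
  have h3 : (z / y) ^ 2 < Real.exp (z - y) := by
    have h4 : (z / y) ^ 2 < Real.exp (z / y - 1) ^ 2 :=
      pow_lt_pow_left₀ h1 (by positivity) two_ne_zero
    refine h4.trans_le ?_
    rw [← Real.exp_nat_mul, Real.exp_le_exp]
    have h5 : ((2 : ℕ) : ℝ) * (z / y - 1) = (z - y) * (2 / y) := by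
      push_cast
      field_simp
    rw [h5]
    exact mul_le_of_le_one_right (by linarith) ((div_le_one hy0).2 hy)
  rw [div_pow, div_lt_iff₀ (by positivity), Real.exp_sub] at h3
  rw [div_lt_div_iff₀ (by positivity) (by positivity)]
  rw [div_mul_eq_mul_div, lt_div_iff₀ (Real.exp_pos y)] at h3
  linarith

theorem exp_div_sq_le {y z : ℝ} (hy : 2 ≤ y) (hyz : y ≤ z) :
    Real.exp y / y ^ 2 ≤ Real.exp z / z ^ 2 := by
  rcases hyz.eq_or_lt with rfl | h
  · exact le_rfl
  · exact (exp_div_sq_lt hy h).le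

section L

variable {c wmin : ℝ} {σ : Config}

theorem Config.wmax_of_nonempty (hne : σ.packets.Nonempty) :
    ∃ u ∈ σ.packets, σ.wmax = σ.window u := by
  rw [Config.wmax, dif_pos hne]
  exact Finset.exists_mem_eq_sup' hne σ.window

theorem Config.window_le_wmax {u : ℕ} (hu : u ∈ σ.packets) : σ.window u ≤ σ.wmax := by
  rw [Config.wmax, dif_pos ⟨u, hu⟩]
  exact Finset.le_sup' σ.window hu

theorem Config.L_of_empty (h : ¬σ.packets.Nonempty) : σ.L = 0 := by
  rw [Config.L, Config.wmax, dif_neg h, zero_div]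

theorem Config.L_eq (hp : LargeParams c wmin) (hσ : σ.Valid wmin) (hne : σ.packets.Nonempty) :
    σ.L = Real.exp (Real.log σ.wmax) / Real.log σ.wmax ^ 2 ∧ 2 ≤ Real.log σ.wmax := by
  obtain ⟨u, hu, hw⟩ := Config.wmax_of_nonempty hne
  have h1 := hp.two_le (hσ u hu).2
  have h2 := hp.two_le_log (hσ u hu).2
  rw [Config.L, hw, Real.exp_log (by linarith)]
  exact ⟨rfl, h2⟩

theorem Config.L_nonneg (hp : LargeParams c wmin) (hσ : σ.Valid wmin) : 0 ≤ σ.L := by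
  by_cases hne : σ.packets.Nonempty
  · rw [(Config.L_eq hp hσ hne).1]
    positivity
  · rw [Config.L_of_empty hne]

theorem Config.L_le_of_log_le (hp : LargeParams c wmin) (hσ : σ.Valid wmin) {z : ℝ}
    (hz : ∀ u ∈ σ.packets, Real.log (σ.window u) ≤ z) : σ.L ≤ Real.exp z / z ^ 2 := by
  by_cases hne : σ.packets.Nonempty
  · obtain ⟨h1, h2⟩ := Config.L_eq hp hσ hne
    obtain ⟨u, hu, hw⟩ := Config.wmax_of_nonempty hne
    rw [h1]
    refine exp_div_sq_le h2 ?_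
    rw [hw]
    exact hz u hu
  · rw [Config.L_of_empty hne]
    positivity

theorem Config.L_le_of_window_le (hp : LargeParams c wmin) (hσ : σ.Valid wmin) {z : ℝ}
    (hz0 : 0 ≤ z) (hz : ∀ u ∈ σ.packets, σ.window u ≤ z) : σ.L ≤ z := by
  by_cases hne : σ.packets.Nonempty
  · obtain ⟨u, hu, hw⟩ := Config.wmax_of_nonempty hne
    have h1 := hp.two_le (hσ u hu).2
    have h2 := hp.one_le_log (hσ u hu).2
    rw [Config.L, hw]
    exact (div_le_self (by linarith) (one_le_pow₀ h2)).trans (hz u hu)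
  · rwa [Config.L_of_empty hne]

theorem Config.log_window_le_of_L_le (hp : LargeParams c wmin) (hσ : σ.Valid wmin) {z : ℝ}
    (hz : 2 ≤ z) (hL : σ.L ≤ Real.exp z / z ^ 2) :
    ∀ u ∈ σ.packets, Real.log (σ.window u) ≤ z := by
  intro u hu
  obtain ⟨h1, h2⟩ := Config.L_eq hp hσ ⟨u, hu⟩
  have h3 := hp.two_le (hσ u hu).2
  refine (Real.log_le_log (by linarith) (Config.window_le_wmax hu)).trans ?_
  by_contra! h4
  have := exp_div_sq_lt hz h4
  rw [h1] at hL
  linarith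

end L

/-- Shrinking all windows by the factor `e ^ r` shrinks `w / ln² w` by at least the factor
`1 - r / 4`. -/
theorem exp_sub_div_sq_le {x r : ℝ} (hx : 100 ≤ x) (hr0 : 0 ≤ r) (hr : r ≤ 1) :
    Real.exp (x - r) / (x - r) ^ 2 ≤ Real.exp x / x ^ 2 * (1 - r / 4) := by
  have h0 : 0 < x - r := by linarith
  have h1 : x ^ 2 * (1 - r / 4) ≤ (x - r) ^ 2 := by
    nlinarith [mul_nonneg hr0 (show 0 ≤ x * (x - 8) by nlinarith)]
  have h2 : Real.exp (-r) ≤ 1 - r / 2 := by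
    rw [Real.exp_neg]
    refine inv_le_of_inv_le₀ (by linarith) ?_
    rw [inv_le_iff_one_le_mul₀ (by linarith)]
    have := Real.add_one_le_exp r
    nlinarith
  have h3 : Real.exp (x - r) = Real.exp x * Real.exp (-r) := by
    rw [← Real.exp_add, sub_eq_add_neg]
  have h4 : Real.exp (-r) * x ^ 2 ≤ (1 - r / 4) * (x - r) ^ 2 := by
    calc Real.exp (-r) * x ^ 2 ≤ (1 - r / 2) * x ^ 2 := by gcongr
      _ ≤ (1 - r / 4) * (x ^ 2 * (1 - r / 4)) := by nlinarith [sq_nonneg x, sq_nonneg (x * r)]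
      _ ≤ _ := mul_le_mul_of_nonneg_left h1 (by linarith)
  rw [h3, div_mul_eq_mul_div, div_le_div_iff₀ (by positivity) (by positivity)]
  nlinarith [mul_le_mul_of_nonneg_left h4 (Real.exp_pos x).le]

/-- The coefficient of `L` in the potential: so small that the drift of `200 N + H` outweighs
every change of `L` if the contention is not low. -/
def coeffL (cτ : ℝ) : ℝ := driftRate / (375 * cτ)

theorem coeffL_pos {cτ : ℝ} (h : 0 < cτ) : 0 < coeffL cτ := by
  have := driftRate_pos
  unfold coeffL; positivity

theorem coeffL_mul {cτ : ℝ} (h : 0 < cτ) : coeffL cτ * cτ = driftRate / 375 := by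
  unfold coeffL; field_simp

theorem coeffL_le {cτ : ℝ} (h : 200 ≤ cτ) : coeffL cτ ≤ driftRate / 75000 := by
  unfold coeffL
  exact div_le_div_of_nonneg_left driftRate_pos.le (by norm_num) (by linarith)

/-- The price of an arrival or of a jammed slot. The quotient is such that a number of them as small
as the fraction `coeffL cτ / 1000000` of `τ` pays for an increase of `coeffL cτ + 3 cτ` times `τ`. -/
def price (cτ : ℝ) : ℝ := 202 + (coeffL cτ + 3 * cτ) / (coeffL cτ / 1000000)

/-- On the event that the windows are controlled and that `200 N + H` does not exceed its drift by
more than a small fraction of `τ`, the potential decreases. -/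
theorem potential_sub_lt {c wmin cτ γ τ x : ℝ} (s : Scale c wmin cτ γ τ x) {σ : Config}
    (hσ : σ.Valid wmin) (hne : σ.packets.Nonempty) (hmax : cτ * τ = max σ.L (Real.sqrt σ.N))
    {e : List SlotRecord × Config} (he : WindowsControlled c wmin γ τ x σ.N e)
    (hE : energyProcess wmin σ.energy e.1 e.2 < Real.exp (1 / 32 * (coeffL cτ / 4096 * τ))) :
    e.2.potential 200 1 (coeffL cτ) - σ.potential 200 1 (coeffL cτ) <
      price cτ * (totalArrivals e.1 + totalJammed e.1) - coeffL cτ / 2048 * τ := by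
  have hx := s.hundred_le
  have hcτ := s.le_cτ
  have hτ := s.one_le_τ
  have hp := s.large
  have hv := he.2.1.1.valid
  have hA0 := totalArrivals_nonneg e.1
  have hJ0 := totalJammed_nonneg e.1
  have hS0 := totalContention_nonneg hp he.2.1.1.past_valid
  set A := totalArrivals e.1
  set J := totalJammed e.1
  set S := totalContention wmin e.1
  set q := coeffL cτ with hq
  have hq0 : 0 < q := coeffL_pos (by linarith)
  have hqc : q * cτ = driftRate / 375 := coeffL_mul (by linarith)
  have hq1 : q ≤ driftRate / 75000 := coeffL_le hcτ
  have hκ := driftRate_pos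
  have hκ1 := driftRate_le
  -- the change of `200 N + H`
  have hY : e.2.energy - σ.energy < 201 * (A + J) - 32 * driftRate * S + q / 4096 * τ := by
    rw [energyProcess, Real.exp_lt_exp] at hE
    linarith
  have hpot : e.2.potential 200 1 q - σ.potential 200 1 q =
      (e.2.energy - σ.energy) + q * (e.2.L - σ.L) := by
    unfold Config.potential Config.energy
    ring
  rw [hpot]
  have hN : 0 < σ.N := by
    rw [Config.N]
    exact_mod_cast Finset.card_pos.2 hne
  have hL0 := Config.L_nonneg hp hσ
  have hE2 : Real.exp (2 * x) = Real.exp x * Real.exp x := by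
    rw [← Real.exp_add]; congr 1; ring
  have hn : σ.N ≤ Real.exp (2 * x) := by
    have h1 : Real.sqrt σ.N ≤ Real.exp x := by
      calc Real.sqrt σ.N ≤ cτ * τ := by rw [hmax]; exact le_max_right _ _
        _ = Real.exp x / x ^ 2 := s.exp_eq.symm
        _ ≤ Real.exp x := div_le_self (Real.exp_pos x).le (one_le_pow₀ (by linarith))
    rw [Real.sqrt_le_left (Real.exp_pos x).le] at h1
    rwa [hE2, ← sq]
  have hL : A ≤ Real.exp (2 * x) → e.2.L ≤ 3 * (cτ * τ) := fun hA => by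
    have h1 := Config.L_le_of_log_le hp hv fun u hu =>
      s.log_window_le_add_one hN hn he.1.le he.2.1.2 hA hu
    refine h1.trans ?_
    rw [← s.exp_eq, Real.exp_add, mul_div_assoc']
    have h2 : x ^ 2 ≤ (x + 1) ^ 2 := by nlinarith
    calc Real.exp x * Real.exp 1 / (x + 1) ^ 2 ≤ Real.exp x * 3 / x ^ 2 := by
          gcongr
          linarith [Real.exp_one_lt_d9]
      _ = _ := by ring
  rcases le_or_gt (q / 1000000 * τ) (A + J) with hbig | hsmall
  · -- many arrivals or jammed slots: they pay for everything
    have hd0 : 0 < q / 1000000 := by positivity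
    have h1 : (q + 3 * cτ) * τ ≤ (q + 3 * cτ) / (q / 1000000) * (A + J) := by
      rw [div_mul_eq_mul_div, le_div_iff₀ hd0]
      nlinarith
    have h2 : q * (e.2.L - σ.L) ≤ A + 3 * cτ * τ := by
      have hq2 : q ≤ 1 := by linarith
      have hL1 := Config.L_nonneg hp hv
      have h3 : e.2.L ≤ A + 3 * cτ * τ := by
        rcases le_or_gt A (Real.exp (2 * x)) with hA | hA
        · linarith [hL hA]
        · have := Config.L_le_of_window_le hp hv hA0 fun u hu =>
            s.window_le_arrivals hN hn he.1.le hv he.2.1.2 hA hu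
          have h5 : 0 ≤ 3 * cτ * τ := by positivity
          linarith
      nlinarith [mul_nonneg hq0.le hL0]
    have h6 : 0 ≤ 32 * driftRate * S := by positivity
    have h7 : q * 1 ≤ q * τ := mul_le_mul_of_nonneg_left hτ hq0.le
    have h8 : price cτ * (A + J) = 202 * (A + J) + (q + 3 * cτ) / (q / 1000000) * (A + J) := by
      rw [price, ← hq]; ring
    rw [h8]
    linarith
  · have hqτ : q / 1000000 * τ ≤ 1 / 1000000 * τ := by
      refine mul_le_mul_of_nonneg_right ?_ (by linarith)
      linarith
    have hA : A ≤ Real.exp (2 * x) := by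
      have h1 := s.τ_le
      have h2 : Real.exp x ≤ Real.exp (2 * x) := Real.exp_le_exp.2 (by linarith)
      linarith
    have hprice : 0 ≤ price cτ * (A + J) := by
      unfold price
      rw [← hq]
      positivity
    have hqτ0 : 0 < q * τ := by positivity
    rcases le_or_gt (1 / 1000 * τ) S with hS | hS
    · -- enough contention: the drift of `200 N + H` wins
      have h1 := mul_le_mul_of_nonneg_left (hL hA) hq0.le
      have h2 : q * (3 * (cτ * τ)) = driftRate / 125 * τ := by
        have : q * (3 * (cτ * τ)) = 3 * (q * cτ) * τ := by ring
        rw [this, hqc]; ring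
      have h3 := mul_le_mul_of_nonneg_left hS (show 0 ≤ 32 * driftRate by positivity)
      have h4 : q * τ ≤ driftRate / 75000 * τ := mul_le_mul_of_nonneg_right hq1 (by linarith)
      have h5 : 0 < driftRate * τ := by positivity
      nlinarith [mul_nonneg hq0.le hL0]
    · -- low contention: the largest window shrinks
      rcases max_choice σ.L (Real.sqrt σ.N) with hc | hc
      · have hr0 : 0 < 1 / (128 * cτ) := by positivity
        have hr1 : 1 / (128 * cτ) ≤ 1 := (div_le_one (by linarith)).2 (by linarith)
        have h1 := Config.L_le_of_log_le hp hv fun u hu =>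
          s.log_window_le_sub hN hn he hA (by linarith) hu
        have h2 := h1.trans (exp_sub_div_sq_le hx hr0.le hr1)
        have h3 : Real.exp x / x ^ 2 * (1 - 1 / (128 * cτ) / 4) = cτ * τ - τ / 512 := by
          rw [s.exp_eq]
          field_simp
          ring
        rw [h3] at h2
        have h4 : e.2.L - σ.L ≤ -(τ / 512) := by
          rw [← hc, ← hmax]
          linarith
        have h5 := mul_le_mul_of_nonneg_left h4 hq0.le
        have h6 : 0 ≤ 32 * driftRate * S := by positivity
        nlinarith
      · have h1 := s.totalContention_eq (n₀ := σ.N)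
          (by rw [hmax, hc, Real.sq_sqrt hN.le]) he hA
        have h2 : τ ≤ e.1.length := by rw [he.1]; exact Nat.le_ceil τ
        change S = _ at h1
        linarith

/-- The probability that `200 N + H` exceeds its drift. -/
theorem measure_energy_le {c wmin : ℝ} (h : LargeParams c wmin) (adv : Adversary) {σ : Config}
    (hσ : σ.Valid wmin) (n : ℕ) {r : ℝ} (hr : 0 < r) :
    (run c wmin adv n [] σ).toOuterMeasure {e | r ≤ energyProcess wmin σ.energy e.1 e.2} ≤
      ENNReal.ofReal (1 / r) := by
  have hmax := run_maximal (c := c) (wmin := wmin) (adv := adv) (T := n) (ε := 0) (r := r)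
    le_rfl hr (Inv := RunInv wmin σ.N) (V := energyProcess wmin σ.energy)
    (fun past ρ => (Real.exp_pos _).le)
    (fun past ρ act hI => hI.next h _ _ act)
    (fun past ρ hI _ => by
      rw [add_zero]
      exact slotMean_energyProcess_le h _ hI.valid _ _)
    n [] σ (by simp) ⟨hσ, by simp [totalArrivals], by simp, by simp⟩
    (fun l r rest hl => by simp at hl)
  have h1 : energyProcess wmin σ.energy [] σ = 1 := by
    simp [energyProcess, totalArrivals, totalJammed, totalContention]
  rw [h1, mul_zero, add_zero] at hmax
  refine le_trans ((PMF.toOuterMeasure _).mono ?_) hmax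
  intro e he he'
  exact absurd he'.2.1.2 (not_lt.2 he)

/-- Every large number is `e ^ x / x ^ 2` for a large `x`. -/
theorem exists_exp_div_sq_eq {X y : ℝ} (hX : 0 < X) (hy : Real.exp X / X ^ 2 ≤ y) :
    ∃ x, X ≤ x ∧ Real.exp x / x ^ 2 = y := by
  obtain ⟨b, hb1, hb2⟩ := ((Real.tendsto_exp_div_pow_atTop 2).eventually_ge_atTop y |>.and
    (Filter.eventually_ge_atTop X)).exists
  have hcont : ContinuousOn (fun x : ℝ => Real.exp x / x ^ 2) (Set.Icc X b) := by
    refine Real.continuous_exp.continuousOn.div (continuous_pow 2).continuousOn fun x hx => ?_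
    have : 0 < x := hX.trans_le hx.1
    positivity
  obtain ⟨x, hx, hxy⟩ := intermediate_value_Icc hb2 hcont ⟨hy, hb1⟩
  exact ⟨x, hx.1, hxy⟩

theorem eventually_rpow_le_exp (γ : ℝ) {b : ℝ} (hb : 0 < b) :
    ∀ᶠ t : ℝ in Filter.atTop, t ^ γ ≤ Real.exp (b * t) := by
  filter_upwards [(isLittleO_rpow_exp_pos_mul_atTop γ hb).bound one_pos,
    Filter.eventually_ge_atTop 0] with t ht ht0
  rwa [one_mul, Real.norm_of_nonneg (Real.rpow_nonneg ht0 γ),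
    Real.norm_of_nonneg (Real.exp_pos _).le] at ht

end Backoff

end

theorem mainTheorem8 (γ : ℝ) (hγ : 1 ≤ γ) :
    ∃ cτ₀ : ℝ, 0 < cτ₀ ∧ ∀ cτ : ℝ, cτ₀ ≤ cτ →
    ∃ c₀ : ℝ, 0 < c₀ ∧ ∀ c : ℝ, c₀ ≤ c →
    ∃ w₀ : ℝ, 2 ≤ w₀ ∧ ∀ wmin : ℝ, w₀ ≤ wmin →
    ∃ α₁ α₂ α₃ : ℝ, 0 < α₃ ∧ α₃ < α₂ ∧ α₂ < α₁ ∧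
    ∃ δ K C : ℝ, 0 < δ ∧ 0 < K ∧ 0 < C ∧
    ∀ (σ : Backoff.Config) (adv : Backoff.Adversary),
      σ.Valid wmin → σ.packets.Nonempty →
      (Backoff.run c wmin adv ⌈σ.tau cτ⌉₊ [] σ).toOuterMeasure
        {e | K * (Backoff.totalArrivals e.1 + Backoff.totalJammed e.1) - δ * σ.tau cτ ≤
          e.2.potential α₁ α₂ α₃ - σ.potential α₁ α₂ α₃} ≤
        ENNReal.ofReal (C * (1 / σ.tau cτ) ^ γ) := by
  refine ⟨200, by norm_num, fun cτ hcτ => ⟨128 * cτ * (γ + 3), by positivity, fun c hc => ?_⟩⟩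
  have hc100 : 100 ≤ c := by nlinarith
  obtain ⟨w₀, hw₀, hlarge⟩ := Backoff.exists_largeParams hc100
  refine ⟨w₀, hw₀, fun wmin hw => ?_⟩
  have hp := hlarge wmin hw
  set q := Backoff.coeffL cτ with hq
  have hq0 : 0 < q := Backoff.coeffL_pos (by linarith)
  have hq1 : q ≤ Backoff.driftRate / 75000 := Backoff.coeffL_le hcτ
  have hκ := Backoff.driftRate_le
  have hK : 0 < Backoff.price cτ := by
    unfold Backoff.price
    rw [← hq]
    positivity
  set X := max 100 (Real.log wmin + 1)
  have hX : 100 ≤ X := le_max_left _ _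
  have hX' : Real.log wmin + 1 ≤ X := le_max_right _ _
  obtain ⟨τ₁, hτ₁⟩ := Filter.eventually_atTop.1
    (Backoff.eventually_rpow_le_exp γ (show 0 < q / 131072 by positivity))
  -- below `τ₀`, the claimed bound for the probability is at least `1`
  set τ₀ := max (max 1 τ₁) (Real.exp X / X ^ 2) with hτ₀
  have hτ₀1 : 1 ≤ τ₀ := (le_max_left _ _).trans (le_max_left _ _)
  refine ⟨200, 1, q, hq0, by linarith, by norm_num, q / 2048, Backoff.price cτ, 3 + τ₀ ^ γ,
    by positivity, hK, by positivity, fun σ adv hσ hne => ?_⟩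
  have hN : 1 ≤ σ.N := by
    rw [Backoff.Config.N]
    exact_mod_cast Finset.card_pos.2 hne
  set τ := σ.tau cτ with hτdef
  have hmax : cτ * τ = max σ.L (Real.sqrt σ.N) := by
    rw [hτdef, Backoff.Config.tau]
    field_simp
  have hτpos : 0 < τ := by
    have h1 : 1 ≤ Real.sqrt σ.N := Real.one_le_sqrt.2 hN
    have h2 : 0 < cτ * τ := by
      rw [hmax]
      exact lt_max_of_lt_right (by linarith)
    exact pos_of_mul_pos_right h2 (by linarith)
  have hpow : (1 / τ) ^ γ = 1 / τ ^ γ := by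
    rw [Real.div_rpow zero_le_one hτpos.le, Real.one_rpow]
  have hτγ : 0 < τ ^ γ := by positivity
  rw [hpow]
  rcases lt_or_ge τ τ₀ with hlt | hge
  · refine (Backoff.toOuterMeasure_le_one _ _).trans ?_
    rw [← ENNReal.ofReal_one]
    refine ENNReal.ofReal_le_ofReal ?_
    rw [mul_one_div, le_div_iff₀ hτγ]
    have := Real.rpow_le_rpow hτpos.le hlt.le (show 0 ≤ γ by linarith)
    linarith
  · have hτ1 : 1 ≤ τ := hτ₀1.trans hge
    obtain ⟨x, hxX, hx⟩ := Backoff.exists_exp_div_sq_eq (X := X) (y := cτ * τ) (by linarith) (by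
      have : Real.exp X / X ^ 2 ≤ τ := (le_max_right _ _).trans hge
      nlinarith)
    have s : Backoff.Scale c wmin cτ γ τ x :=
      ⟨hp, hX.trans hxX, by linarith, hcτ, hγ, hc, hx, hτ1⟩
    have h1 := s.measure_windows_le adv hσ hne
      (Backoff.Config.log_window_le_of_L_le hp hσ (by linarith)
        (by rw [hx, hmax]; exact le_max_left _ _))
    have h2 := Backoff.measure_energy_le hp adv hσ ⌈τ⌉₊
      (Real.exp_pos (1 / 32 * (q / 4096 * τ)))
    have h3 : 1 / Real.exp (1 / 32 * (q / 4096 * τ)) ≤ 1 / τ ^ γ := by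
      refine one_div_le_one_div_of_le hτγ ?_
      have h4 := hτ₁ τ (((le_max_right _ _).trans (le_max_left _ _)).trans hge)
      have h5 : 1 / 32 * (q / 4096 * τ) = q / 131072 * τ := by ring
      rwa [h5]
    refine le_trans (((Backoff.run c wmin adv ⌈τ⌉₊ [] σ).toOuterMeasure.mono ?_).trans
      (MeasureTheory.measure_union_le _ _)) ((add_le_add h1 h2).trans ?_)
    · intro e he
      by_contra hcon
      simp only [Set.mem_union, Set.mem_ofPred_eq, not_or, not_not, not_le] at hcon
      exact absurd he (not_le.2 (Backoff.potential_sub_lt s hσ hne hmax hcon.1 hcon.2))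
    · rw [← ENNReal.ofReal_add (by positivity) (by positivity)]
      refine ENNReal.ofReal_le_ofReal ?_
      have h6 : 0 ≤ τ₀ ^ γ * (1 / τ ^ γ) := by positivity
      have h7 : 2 / τ ^ γ = 2 * (1 / τ ^ γ) := by ring
      rw [h7]
      linarith
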